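/- Let $N_b<N_a$ and $N_e$ be the numbers of antennas of Bob, Alice and Eve. Let $\mathbf H\in\mathbb C^{N_b\times N_a}$ and $\mathbf G\in\mathbb C^{N_e\times N_a}$ be independent random matrices with i.i.d. $\mathcal{CN}(0,1)$ entries. For each value of $\mathbf H$ let $\mathbf V=[\mathbf V_1\ \mathbf V_0]$ be a unitary matrix of right singular vectors from a singular value decomposition $\mathbf H=\mathbf U[\mathbf\Lambda\ \mathbf 0]\mathbf V^H$, where $\mathbf V_1$ has $N_b$ and $\mathbf V_0$ has $N_a-N_b$ columns. Alice sends $\mathbf x=\mathbf V_1\mathbf s+\mathbf V_0\mathbf r$ with information signal $\mathbf s\sim\mathcal{CN}(\mathbf 0,\sigma_s^2\mathbf I)$, $\sigma_s^2>0$, and artificial noise (AN) $\mathbf r\sim\mathcal{CN}(\mathbf 0,\sigma_r^2\mathbf I)$, $\sigma_r^2\ge 0$. Bob receives $\mathbf y=\mathbf H\mathbf x+\mathbf u$ with $\mathbf u\sim\mathcal{CN}(\mathbf 0,\sigma_u^2\mathbf I)$, $\sigma_u^2>0$. Eve, who knows $\mathbf G\mathbf V_0$, applies artificial-noise elimination (ANE)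 and obtains $\mathbf z=\mathbf W(\mathbf G\mathbf x+\mathbf n)$ with $\mathbf n\sim\mathcal{CN}(\mathbf 0,\sigma_n^2\mathbf I)$, $\sigma_n^2>0$. Here $\mathbf W\in\mathbb C^{N_w\times N_e}$, chosen as a function of $\mathbf G\mathbf V_0$, has orthonormal rows and minimizes $\operatorname{tr}(\mathbf W'\mathbf G\mathbf V_0\mathbf V_0^H\mathbf G^H\mathbf W'^H)$ among all $\mathbf W'\in\mathbb C^{N_w\times N_e}$ with $\operatorname{tr}(\mathbf W'\mathbf W'^H)=N_w$, where $N_w=N_e-N_a+N_b$ if $N_e>N_a-N_b$ and $N_w=1$ otherwise. Given the channels, $\mathbf s,\mathbf r,\mathbf u$ are independent, and so are $\mathbf s,\mathbf r,\mathbf n$. The average secrecy rate is $$\bar R_s=\bigl[\mathrm E_{\mathbf H}[I(\mathbf s;\mathbf y\mid\mathbf H)]-\mathrm E_{\mathbf H,\mathbf G}[I(\mathbf s;\mathbf z\mid\mathbf H,\mathbf G)]\bigr]^+ ,$$ where $I$ is mutual information in bits and $[x]^+=\max(x,0)$. Put $\gamma=\sigma_n^2/\sigma_u^2$. If $\gamma\le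 N_b/N_a$ and $N_e\ge 2N_a-N_b$, then, for every choice of $\mathbf V$ and $\mathbf W$ as above, both expectations are well defined and finite, and $\bar R_s=0$. -/

import Mathlib

open MeasureTheory ProbabilityTheory InformationTheory
open scoped NNReal ENNReal Matrix

namespace Wiretap

noncomputable section

/-! ### Circularly symmetric complex Gaussian laws -/

/-- The law `CN(0, v)` on `ℂ`: real and imaginary part are independent, centred real Gaussians of
variance `v / 2` each. -/
def complexGaussian (v : ℝ≥0) : Measure ℂ :=
  ((gaussianReal 0 (v / 2)).prod (gaussianReal 0 (v / 2))).map
    (fun p : ℝ × ℝ => (⟨p.1, p.2⟩ : ℂ))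

/-- The law `CN(0, v I_k)` on `ℂ^k`. -/
def complexGaussianVec (k : ℕ) (v : ℝ≥0) : Measure (Fin k → ℂ) :=
  Measure.pi fun _ => complexGaussian v

/-- The uncorrelated Rayleigh-fading channel: the law of an `r × c` array with i.i.d. `CN(0, 1)`
entries. -/
def rayleigh (r c : ℕ) : Measure (Fin r → Fin c → ℂ) :=
  Measure.pi fun _ => complexGaussianVec c 1

/-! ### Mutual information -/

/-- The mutual information `I(X; Y)`, in bits: the Kullback-Leibler divergence of the joint law
from the product of the marginal laws, divided by `log 2`. -/
def mutualInfo {Ω 𝓧 𝓨 : Type*} [MeasurableSpace Ω] [MeasurableSpace 𝓧] [MeasurableSpace 𝓨]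
    (P : Measure Ω) (X : Ω → 𝓧) (Y : Ω → 𝓨) : ℝ≥0∞ :=
  klDiv (P.map fun ω => (X ω, Y ω)) ((P.map X).prod (P.map Y)) / ENNReal.ofReal (Real.log 2)

/-! ### The artificial-noise scheme at the transmitter -/

/-- `V = [V₁ V₀]` is a unitary matrix of right singular vectors of `H`, i.e. the right factor of
some singular value decomposition `H = U [Λ 0] Vᴴ`, where `V₁` has `Nb` columns and `V₀` has
`Na - Nb` columns. -/
def IsRightSingular {Na Nb : ℕ} (H : Matrix (Fin Nb) (Fin Na) ℂ)
    (V : Matrix (Fin Na) (Fin Nb ⊕ Fin (Na - Nb)) ℂ) : Prop :=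
  Vᴴ * V = 1 ∧ V * Vᴴ = 1 ∧
    ∃ (U : Matrix (Fin Nb) (Fin Nb) ℂ) (Λ : Fin Nb → ℝ),
      U ∈ Matrix.unitaryGroup (Fin Nb) ℂ ∧ (∀ i, 0 ≤ Λ i) ∧
      H = U *
        (Matrix.fromCols (Matrix.diagonal fun i => (Λ i : ℂ)) 0 :
          Matrix (Fin Nb) (Fin Nb ⊕ Fin (Na - Nb)) ℂ) * Vᴴ

/-- The transmitted vector `x = V₁ s + V₀ r`. -/
def transmit {Na Nb : ℕ} (V : Matrix (Fin Na) (Fin Nb ⊕ Fin (Na - Nb)) ℂ)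
    (s : Fin Nb → ℂ) (r : Fin (Na - Nb) → ℂ) : Fin Na → ℂ :=
  V.toCols₁ *ᵥ s + V.toCols₂ *ᵥ r

/-! ### The artificial-noise elimination at the eavesdropper -/

/-- The dimension `N_w` of Eve's signal after projection: `Ne - (Na - Nb)` if
`Ne > Na - Nb`, and `1` otherwise. -/
def aneDim (Na Nb Ne : ℕ) : ℕ := if Na - Nb < Ne then Ne - (Na - Nb) else 1

/-- The residual noise power `tr (W M Mᴴ Wᴴ)`, where `M = G V₀` is the effective channel of the
artificial noise. -/
def residualPower {Ne k Nw : ℕ} (M : Matrix (Fin Ne) (Fin k) ℂ)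
    (W : Matrix (Fin Nw) (Fin Ne) ℂ) : ℝ :=
  (W * M * Mᴴ * Wᴴ).trace.re

/-- `W` is an elimination matrix for the effective noise channel `M`: it has orthonormal rows and
minimizes the residual noise power among all `W'` with `tr (W' W'ᴴ) = N_w`. -/
def IsEliminator {Ne k Nw : ℕ} (M : Matrix (Fin Ne) (Fin k) ℂ)
    (W : Matrix (Fin Nw) (Fin Ne) ℂ) : Prop :=
  W * Wᴴ = 1 ∧
    ∀ W' : Matrix (Fin Nw) (Fin Ne) ℂ, (W' * W'ᴴ).trace = (Nw : ℂ) →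
      residualPower M W ≤ residualPower M W'

/-! ### Rates -/

section Rates

variable {Na Nb Ne Nw : ℕ}

/-- `I(s; y | H)` for `y = H x + u`, `x = V₁ s + V₀ r`, where `s`, `r`, `u` are independent with
laws `CN(0, σs2 I)`, `CN(0, σr2 I)`, `CN(0, σu2 I)`. -/
def bobInfo (σs2 σr2 σu2 : ℝ≥0) (H : Matrix (Fin Nb) (Fin Na) ℂ)
    (V : Matrix (Fin Na) (Fin Nb ⊕ Fin (Na - Nb)) ℂ) : ℝ≥0∞ :=
  mutualInfo
    ((complexGaussianVec Nb σs2).prod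
      ((complexGaussianVec (Na - Nb) σr2).prod (complexGaussianVec Nb σu2)))
    (fun ω => ω.1)
    (fun ω => H *ᵥ transmit V ω.1 ω.2.1 + ω.2.2)

/-- `I(s; z | H, G)` for `z = W (G x + n)`, `x = V₁ s + V₀ r`, where `s`, `r`, `n` are independent
with laws `CN(0, σs2 I)`, `CN(0, σr2 I)`, `CN(0, σn2 I)`. -/
def eveInfo (σs2 σr2 σn2 : ℝ≥0) (G : Matrix (Fin Ne) (Fin Na) ℂ)
    (V : Matrix (Fin Na) (Fin Nb ⊕ Fin (Na - Nb)) ℂ) (W : Matrix (Fin Nw) (Fin Ne) ℂ) : ℝ≥0∞ :=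
  mutualInfo
    ((complexGaussianVec Nb σs2).prod
      ((complexGaussianVec (Na - Nb) σr2).prod (complexGaussianVec Ne σn2)))
    (fun ω => ω.1)
    (fun ω => W *ᵥ (G *ᵥ transmit V ω.1 ω.2.1 + ω.2.2))

/-- Bob's instantaneous rate as a function of the channel `H`, when the transmitter uses the right
singular vectors `V H`. -/
def bobRate (σs2 σr2 σu2 : ℝ≥0)
    (V : Matrix (Fin Nb) (Fin Na) ℂ → Matrix (Fin Na) (Fin Nb ⊕ Fin (Na - Nb)) ℂ)
    (h : Fin Nb → Fin Na → ℂ) : ℝ≥0∞ :=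
  bobInfo σs2 σr2 σu2 (Matrix.of h) (V (Matrix.of h))

/-- Eve's instantaneous rate as a function of the channels `(H, G)`, when the transmitter uses the
right singular vectors `V H` and Eve, who knows `G V₀`, uses the elimination matrix `W (G V₀)`. -/
def eveRate (σs2 σr2 σn2 : ℝ≥0)
    (V : Matrix (Fin Nb) (Fin Na) ℂ → Matrix (Fin Na) (Fin Nb ⊕ Fin (Na - Nb)) ℂ)
    (W : Matrix (Fin Ne) (Fin (Na - Nb)) ℂ → Matrix (Fin Nw) (Fin Ne) ℂ)
    (hg : (Fin Nb → Fin Na → ℂ) × (Fin Ne → Fin Na → ℂ)) : ℝ≥0∞ :=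
  eveInfo σs2 σr2 σn2 (Matrix.of hg.2) (V (Matrix.of hg.1))
    (W (Matrix.of hg.2 * (V (Matrix.of hg.1)).toCols₂))

/-- Bob's average rate `E_H [I(s; y | H)]`. -/
def avgBobRate (σs2 σr2 σu2 : ℝ≥0)
    (V : Matrix (Fin Nb) (Fin Na) ℂ → Matrix (Fin Na) (Fin Nb ⊕ Fin (Na - Nb)) ℂ) : ℝ≥0∞ :=
  ∫⁻ h, bobRate σs2 σr2 σu2 V h ∂(rayleigh Nb Na)

/-- Eve's average rate `E_{H,G} [I(s; z | H, G)]`, the channels `H` and `G` being independent. -/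
def avgEveRate (σs2 σr2 σn2 : ℝ≥0)
    (V : Matrix (Fin Nb) (Fin Na) ℂ → Matrix (Fin Na) (Fin Nb ⊕ Fin (Na - Nb)) ℂ)
    (W : Matrix (Fin Ne) (Fin (Na - Nb)) ℂ → Matrix (Fin Nw) (Fin Ne) ℂ) : ℝ≥0∞ :=
  ∫⁻ hg, eveRate σs2 σr2 σn2 V W hg ∂((rayleigh Nb Na).prod (rayleigh Ne Na))

/-- The average secrecy rate: the positive part of the difference of Bob's and Eve's average
rates. -/
def avgSecrecyRate (σs2 σr2 σu2 σn2 : ℝ≥0)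
    (V : Matrix (Fin Nb) (Fin Na) ℂ → Matrix (Fin Na) (Fin Nb ⊕ Fin (Na - Nb)) ℂ)
    (W : Matrix (Fin Ne) (Fin (Na - Nb)) ℂ → Matrix (Fin Nw) (Fin Ne) ℂ) : ℝ :=
  max ((avgBobRate σs2 σr2 σu2 V).toReal - (avgEveRate σs2 σr2 σn2 V W).toReal) 0

end Rates

end

end Wiretap

/-!
Eve's elimination is perfect: since `Ne > Na - Nb`, the noise channel `G V₀` has a nontrivial left
kernel, so the minimal residual power is `0` and `W G V₀ = 0` (`IsEliminator.mul_eq_zero`). Bob does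
not see the artificial noise either, because `H V₀ = 0`. Both of them therefore observe `s` through
a linear channel with white Gaussian noise, and the mutual information is the log-determinant
capacity `log₂ det (1 + c A Aᴴ)` (`mutualInfo_eq`): for Bob `A = H` and `c = σs2 / σu2`, for Eve
`A = W G V₁` and `c = σs2 / σn2`.

For fixed `H`, the blocks `G V₁` and `G V₀` of the Gaussian matrix `G V` are independent
(`measurePreserving_recombine`), and `W` depends on `G V₀` only. Hence `W G V₁` is a Gaussian matrix
with `Ne - (Na - Nb) ≥ Na` rows and `Nb` columns. Its first `Na` rows have the law of `Hᵀ`, and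
dropping the other rows or lowering `c` from `σs2 / σn2` to `σs2 / σu2` can only lower the capacity
(`logDet_mul_le`); here `σn2 ≤ σu2` because `γ ≤ Nb / Na < 1`. So Eve's average rate is at least
Bob's (`avgBobRate_le_lintegral`). Finiteness follows from `log det (1 + P) ≤ tr P`
(`logDet_le`).

Neither `V` nor `W` is assumed to be measurable. Bob's rate is a function of `H` alone. When `H` and
`G` have full rank, which is almost sure, Eve's Gram matrix `(W G V₁)ᴴ (W G V₁)` is the inverse of
`V₁ᴴ (Gᴴ G)⁻¹ V₁`, and her rate is an explicit rational function of `H` and `G` inside a logarithm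
(`logDet_eq_eveLogDet`). This gives almost everywhere measurability and allows Fubini's theorem.
-/

namespace Wiretap

/-! ### Gaussian laws and their characteristic functions -/

lemma measurable_complex_mk : Measurable (fun p : ℝ × ℝ => (⟨p.1, p.2⟩ : ℂ)) :=
  Complex.measurableEquivRealProd.symm.measurable

instance (v : ℝ≥0) : IsProbabilityMeasure (complexGaussian v) :=
  Measure.isProbabilityMeasure_map measurable_complex_mk.aemeasurable

instance (k : ℕ) (v : ℝ≥0) : IsProbabilityMeasure (complexGaussianVec k v) := by
  unfold complexGaussianVec; infer_instance

instance (r c : ℕ) : IsProbabilityMeasure (rayleigh r c) := by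
  unfold rayleigh; infer_instance

lemma integral_exp_complexGaussian (v : ℝ≥0) (a : ℂ) :
    ∫ z, Complex.exp ((star a * z).re * Complex.I) ∂(complexGaussian v)
      = Complex.exp (-(v / 4 * ‖a‖ ^ 2 : ℝ)) := by
  rw [complexGaussian, integral_map measurable_complex_mk.aemeasurable
    (by fun_prop : Continuous fun z : ℂ =>
      Complex.exp ((star a * z).re * Complex.I)).aestronglyMeasurable]
  have h : ∀ p : ℝ × ℝ, Complex.exp ((star a * (⟨p.1, p.2⟩ : ℂ)).re * Complex.I) =
      Complex.exp (a.re * p.1 * Complex.I) * Complex.exp (a.im * p.2 * Complex.I) := by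
    intro p
    rw [← Complex.exp_add]
    congr 1
    simp
    ring
  simp_rw [h]
  rw [integral_prod_mul (fun x : ℝ => Complex.exp (a.re * x * Complex.I))
    (fun x : ℝ => Complex.exp (a.im * x * Complex.I)), ← charFun_apply_real,
    ← charFun_apply_real, charFun_gaussianReal, charFun_gaussianReal, ← Complex.exp_add,
    Complex.sq_norm, Complex.normSq_apply]
  congr 1
  push_cast
  ring

lemma integral_exp_vec {k : ℕ} (v : ℝ≥0) (a : Fin k → ℂ) :
    ∫ x, Complex.exp ((star a ⬝ᵥ x).re * Complex.I) ∂(complexGaussianVec k v)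
      = Complex.exp (-(v / 4 * ∑ i, ‖a i‖ ^ 2 : ℝ)) := by
  have h : ∀ x : Fin k → ℂ, Complex.exp ((star a ⬝ᵥ x).re * Complex.I) =
      ∏ i, Complex.exp ((star (a i) * x i).re * Complex.I) := by
    intro x
    rw [← Complex.exp_sum, ← Finset.sum_mul, ← Complex.ofReal_sum, ← Complex.re_sum]
    rfl
  simp_rw [h]
  rw [complexGaussianVec, integral_fintype_prod_eq_prod
    (fun i z => Complex.exp ((star (a i) * z).re * Complex.I))]
  simp_rw [integral_exp_complexGaussian]
  rw [← Complex.exp_sum]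
  congr 1
  push_cast
  rw [Finset.sum_neg_distrib, Finset.mul_sum]

lemma re_trace_conjTranspose_mul {r c : ℕ} (a : Matrix (Fin r) (Fin c) ℂ)
    (x : Fin r → Fin c → ℂ) :
    (Matrix.trace (aᴴ * Matrix.of x)).re = ∑ i, (star (a i) ⬝ᵥ x i).re := by
  simp only [Matrix.trace, Matrix.diag_apply, Matrix.mul_apply, Matrix.conjTranspose_apply,
    Matrix.of_apply, dotProduct, Pi.star_apply, Complex.re_sum]
  exact Finset.sum_comm

lemma re_trace_conjTranspose_mul_self {m n : Type*} [Fintype m] [Fintype n] (a : Matrix m n ℂ) :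
    (Matrix.trace (aᴴ * a)).re = ∑ i, ∑ j, ‖a i j‖ ^ 2 := by
  simp only [Matrix.trace, Matrix.diag_apply, Matrix.mul_apply, Matrix.conjTranspose_apply,
    Complex.re_sum]
  rw [Finset.sum_comm]
  refine Finset.sum_congr rfl fun i _ => Finset.sum_congr rfl fun j _ => ?_
  rw [Complex.sq_norm, Complex.normSq_apply]
  simp

lemma integral_exp_rayleigh {r c : ℕ} (a : Matrix (Fin r) (Fin c) ℂ) :
    ∫ x, Complex.exp ((Matrix.trace (aᴴ * Matrix.of x)).re * Complex.I) ∂(rayleigh r c)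
      = Complex.exp (-((Matrix.trace (aᴴ * a)).re / 4 : ℝ)) := by
  simp_rw [re_trace_conjTranspose_mul, re_trace_conjTranspose_mul_self]
  have h : ∀ x : Fin r → Fin c → ℂ,
      Complex.exp ((∑ i, (star (a i) ⬝ᵥ x i).re : ℝ) * Complex.I) =
      ∏ i, Complex.exp ((star (a i) ⬝ᵥ x i).re * Complex.I) := by
    intro x
    rw [← Complex.exp_sum, ← Finset.sum_mul, ← Complex.ofReal_sum]
  simp_rw [h]
  rw [rayleigh, integral_fintype_prod_eq_prod
    (fun i z => Complex.exp ((star (a i) ⬝ᵥ z).re * Complex.I))]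
  simp_rw [integral_exp_vec]
  rw [← Complex.exp_sum]
  congr 1
  push_cast
  rw [Finset.sum_neg_distrib, Finset.sum_div]
  congr 1
  refine Finset.sum_congr rfl fun i _ => ?_
  ring

lemma dual_complex_eq (ℓ : StrongDual ℝ ℂ) (z : ℂ) :
    ℓ z = (star (⟨ℓ 1, ℓ Complex.I⟩ : ℂ) * z).re := by
  have hz : z = z.re • (1 : ℂ) + z.im • Complex.I := by
    apply Complex.ext <;> simp
  conv_lhs => rw [hz]
  rw [map_add, map_smul, map_smul]
  simp
  ring

lemma exists_dual_vec_eq {k : ℕ} (ℓ : StrongDual ℝ (Fin k → ℂ)) :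
    ∃ a : Fin k → ℂ, ∀ x, ℓ x = (star a ⬝ᵥ x).re := by
  refine ⟨fun i => ⟨(ℓ.comp (.single ℝ (fun _ => ℂ) i)) 1,
    (ℓ.comp (.single ℝ (fun _ => ℂ) i)) Complex.I⟩, fun x => ?_⟩
  rw [← ℓ.sum_comp_single, dotProduct, Complex.re_sum]
  exact Finset.sum_congr rfl fun i _ => dual_complex_eq _ _

/-- Finite measures on `ℂ^k` are determined by their characteristic functions. -/
lemma ext_of_integral_exp {k : ℕ} {μ ν : Measure (Fin k → ℂ)} [IsFiniteMeasure μ]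
    [IsFiniteMeasure ν]
    (h : ∀ a : Fin k → ℂ, ∫ x, Complex.exp ((star a ⬝ᵥ x).re * Complex.I) ∂μ
      = ∫ x, Complex.exp ((star a ⬝ᵥ x).re * Complex.I) ∂ν) :
    μ = ν := by
  refine Measure.ext_of_charFunDual (funext fun ℓ => ?_)
  obtain ⟨a, ha⟩ := exists_dual_vec_eq ℓ
  rw [charFunDual_apply, charFunDual_apply]
  simp_rw [ha]
  exact h a

/-- A finite measure with the characteristic function of the Rayleigh-fading channel is the
Rayleigh-fading channel. -/
lemma eq_rayleigh {r c : ℕ} (μ : Measure (Fin r → Fin c → ℂ)) [IsFiniteMeasure μ]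
    (h : ∀ a : Matrix (Fin r) (Fin c) ℂ,
      ∫ x, Complex.exp ((Matrix.trace (aᴴ * Matrix.of x)).re * Complex.I) ∂μ
      = Complex.exp (-((Matrix.trace (aᴴ * a)).re / 4 : ℝ))) :
    μ = rayleigh r c := by
  refine Measure.ext_of_charFunDual (funext fun ℓ => ?_)
  have : ∃ a : Matrix (Fin r) (Fin c) ℂ, ∀ x, ℓ x = (Matrix.trace (aᴴ * Matrix.of x)).re := by
    choose a ha using fun i => exists_dual_vec_eq (ℓ.comp (.single ℝ (fun _ => Fin c → ℂ) i))
    refine ⟨Matrix.of a, fun x => ?_⟩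
    rw [re_trace_conjTranspose_mul, ← ℓ.sum_comp_single]
    exact Finset.sum_congr rfl fun i _ => ha i _
  obtain ⟨a, ha⟩ := this
  rw [charFunDual_apply, charFunDual_apply]
  simp_rw [ha]
  rw [h, integral_exp_rayleigh]

/-! ### Densities and second moments -/

lemma complexGaussian_eq_withDensity {v : ℝ≥0} (hv : 0 < v) :
    complexGaussian v = volume.withDensity
      (fun z => ENNReal.ofReal ((Real.pi * v)⁻¹ * Real.exp (-(‖z‖ ^ 2 / v)))) := by
  have hv2 : v / 2 ≠ 0 := by positivity
  have hvr : (0 : ℝ) < v := hv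
  have hmp := Complex.volume_preserving_equiv_real_prod.symm
  rw [complexGaussian, gaussianReal_of_var_ne_zero _ hv2,
    prod_withDensity (by fun_prop) (by fun_prop)]
  ext s hs
  rw [Measure.map_apply measurable_complex_mk hs, withDensity_apply _ (measurable_complex_mk hs),
    withDensity_apply _ hs]
  change ∫⁻ a in Complex.measurableEquivRealProd.symm ⁻¹' s, _ = _
  rw [← hmp.setLIntegral_comp_preimage hs (by fun_prop)]
  refine lintegral_congr fun p => ?_
  rw [gaussianPDF, gaussianPDF, ← ENNReal.ofReal_mul (gaussianPDFReal_nonneg _ _ _),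
    gaussianPDFReal, gaussianPDFReal, mul_mul_mul_comm, ← mul_inv,
    Real.mul_self_sqrt (by positivity), ← Real.exp_add, Complex.sq_norm, Complex.normSq_apply]
  congr 3
  · push_cast; ring
  · push_cast
    simp [Complex.measurableEquivRealProd]
    field_simp
    ring

/-- Tonelli's theorem for a product of functions of one coordinate each. -/
lemma lintegral_fin_prod_eq_prod {n : ℕ} {E : Type*} [MeasurableSpace E] (μ : Measure E)
    [SigmaFinite μ] (f : Fin n → E → ℝ≥0∞) (hf : ∀ i, Measurable (f i)) :
    ∫⁻ x, ∏ i, f i (x i) ∂(Measure.pi fun _ : Fin n => μ) = ∏ i, ∫⁻ x, f i x ∂μ := by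
  induction n with
  | zero => simp
  | succ n ih =>
    rw [Fin.prod_univ_succ, ← ih (fun i => f i.succ) (fun i => hf _),
      ← lintegral_prod_mul (hf 0).aemeasurable (Finset.measurable_prod _
        fun i _ => (hf i.succ).comp (measurable_pi_apply i)).aemeasurable,
      ← ((measurePreserving_piFinSuccAbove (fun _ : Fin (n + 1) => μ) 0).symm).lintegral_comp
        (f := fun x => ∏ i, f i (x i))
        (Finset.measurable_prod _ fun i _ => (hf i).comp (measurable_pi_apply i))]
    refine lintegral_congr fun x => ?_
    rw [Fin.prod_univ_succ]
    rfl

lemma pi_withDensity {n : ℕ} {E : Type*} [MeasurableSpace E] (μ : Measure E)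
    [SigmaFinite μ] (f : E → ℝ≥0∞) (hf : Measurable f) [SigmaFinite (μ.withDensity f)] :
    Measure.pi (fun _ : Fin n => μ.withDensity f) =
      (Measure.pi fun _ : Fin n => μ).withDensity (fun x => ∏ i, f (x i)) := by
  refine Measure.pi_eq fun s hs => ?_
  rw [withDensity_apply _ (.univ_pi hs), ← lintegral_indicator (.univ_pi hs)]
  have h : ∀ x : Fin n → E, (Set.univ.pi s).indicator (fun x => ∏ i, f (x i)) x =
      ∏ i, (s i).indicator f (x i) := by
    intro x
    by_cases hx : x ∈ Set.univ.pi s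
    · rw [Set.indicator_of_mem hx]
      exact Finset.prod_congr rfl fun i _ => (Set.indicator_of_mem (hx i trivial) f).symm
    · rw [Set.indicator_of_notMem hx]
      simp only [Set.mem_univ_pi, not_forall] at hx
      obtain ⟨i, hi⟩ := hx
      exact (Finset.prod_eq_zero (Finset.mem_univ i) (Set.indicator_of_notMem hi f)).symm
  simp_rw [h]
  rw [lintegral_fin_prod_eq_prod _ _ fun i => hf.indicator (hs i)]
  refine Finset.prod_congr rfl fun i _ => ?_
  rw [lintegral_indicator (hs i), withDensity_apply _ (hs i)]

/-- The Lebesgue density of `CN(0, v I)` on `ℂ^k`. -/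
noncomputable def gaussianDensity (k : ℕ) (v : ℝ≥0) (x : Fin k → ℂ) : ℝ :=
  ((Real.pi * v)⁻¹) ^ k * Real.exp (-((∑ i, ‖x i‖ ^ 2) / v))

lemma gaussianDensity_pos {k : ℕ} {v : ℝ≥0} (hv : 0 < v) (x : Fin k → ℂ) :
    0 < gaussianDensity k v x := by
  have : (0 : ℝ) < v := hv
  unfold gaussianDensity
  positivity

lemma measurable_gaussianDensity (k : ℕ) (v : ℝ≥0) : Measurable (gaussianDensity k v) := by
  unfold gaussianDensity
  fun_prop

lemma complexGaussianVec_eq_withDensity {k : ℕ} {v : ℝ≥0} (hv : 0 < v) :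
    complexGaussianVec k v =
      volume.withDensity (fun x => ENNReal.ofReal (gaussianDensity k v x)) := by
  have hσ : SigmaFinite ((volume : Measure ℂ).withDensity
      (fun z => ENNReal.ofReal ((Real.pi * v)⁻¹ * Real.exp (-(‖z‖ ^ 2 / v))))) := by
    rw [← complexGaussian_eq_withDensity hv]; infer_instance
  rw [complexGaussianVec, complexGaussian_eq_withDensity hv, pi_withDensity _ _ (by fun_prop),
    volume_pi]
  congr 1
  funext x
  rw [← ENNReal.ofReal_prod_of_nonneg (fun i _ => by positivity), gaussianDensity,
    Finset.prod_mul_distrib, ← Real.exp_sum, Finset.sum_neg_distrib, Finset.sum_div]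
  simp

lemma rayleigh_absolutelyContinuous (r c : ℕ) : rayleigh r c ≪ volume := by
  have hσ : SigmaFinite ((volume : Measure (Fin c → ℂ)).withDensity
      (fun x => ENNReal.ofReal (gaussianDensity c 1 x))) := by
    rw [← complexGaussianVec_eq_withDensity one_pos]; infer_instance
  rw [rayleigh, complexGaussianVec_eq_withDensity one_pos,
    pi_withDensity _ _ (measurable_gaussianDensity c 1).ennreal_ofReal, volume_pi]
  exact withDensity_absolutelyContinuous _ _

lemma integral_sq_gaussianReal (v : ℝ≥0) : ∫ x, x ^ 2 ∂(gaussianReal 0 v) = v := by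
  have h := variance_fun_id_gaussianReal (μ := 0) (v := v)
  rwa [variance_of_integral_eq_zero aemeasurable_id' (by simp)] at h

lemma integrable_sq_gaussianReal (v : ℝ≥0) : Integrable (fun x => x ^ 2) (gaussianReal 0 v) :=
  (memLp_id_gaussianReal 2).integrable_sq

lemma integrable_norm_sq_complexGaussian (v : ℝ≥0) :
    Integrable (fun z => ‖z‖ ^ 2) (complexGaussian v) ∧
      ∫ z, ‖z‖ ^ 2 ∂(complexGaussian v) = v := by
  have hc : AEStronglyMeasurable (fun z : ℂ => ‖z‖ ^ 2) (complexGaussian v) :=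
    (by fun_prop : Continuous fun z : ℂ => ‖z‖ ^ 2).aestronglyMeasurable
  have h : (fun p : ℝ × ℝ => ‖(⟨p.1, p.2⟩ : ℂ)‖ ^ 2) = fun p => p.1 ^ 2 + p.2 ^ 2 := by
    funext p
    rw [Complex.sq_norm, Complex.normSq_apply]
    ring
  have h1 := (integrable_sq_gaussianReal (v / 2)).comp_fst (gaussianReal 0 (v / 2))
  have h2 := (integrable_sq_gaussianReal (v / 2)).comp_snd (gaussianReal 0 (v / 2))
  rw [complexGaussian] at hc ⊢
  rw [integrable_map_measure hc measurable_complex_mk.aemeasurable,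
    integral_map measurable_complex_mk.aemeasurable hc]
  change Integrable (fun p : ℝ × ℝ => ‖(⟨p.1, p.2⟩ : ℂ)‖ ^ 2) _ ∧ _
  rw [h]
  refine ⟨h1.add h2, ?_⟩
  rw [integral_add h1 h2, integral_fun_fst (fun x : ℝ => x ^ 2),
    integral_fun_snd (fun x : ℝ => x ^ 2), integral_sq_gaussianReal]
  simp

lemma integrable_norm_sq_eval {k : ℕ} (v : ℝ≥0) (i : Fin k) :
    Integrable (fun x => ‖x i‖ ^ 2) (complexGaussianVec k v) ∧
      ∫ x, ‖x i‖ ^ 2 ∂(complexGaussianVec k v) = v := by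
  have hmp := measurePreserving_eval (fun _ : Fin k => complexGaussian v) i
  obtain ⟨h1, h2⟩ := integrable_norm_sq_complexGaussian v
  refine ⟨hmp.integrable_comp_of_integrable h1, ?_⟩
  rw [← h2, ← hmp.map_eq, integral_map hmp.measurable.aemeasurable
    (by fun_prop : Continuous fun z : ℂ => ‖z‖ ^ 2).aestronglyMeasurable]
  rfl

lemma integrable_sum_norm_sq (k : ℕ) (v : ℝ≥0) :
    Integrable (fun x => ∑ i, ‖x i‖ ^ 2) (complexGaussianVec k v) :=
  integrable_finsetSum _ fun i _ => (integrable_norm_sq_eval v i).1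

lemma integral_sum_norm_sq (k : ℕ) (v : ℝ≥0) :
    ∫ x, ∑ i, ‖x i‖ ^ 2 ∂(complexGaussianVec k v) = k * v := by
  rw [integral_finsetSum _ fun i _ => (integrable_norm_sq_eval v i).1]
  simp_rw [(integrable_norm_sq_eval v _).2]
  simp

lemma integrable_sum_norm_sq_rayleigh (r c : ℕ) :
    Integrable (fun x => ∑ i, ∑ j, ‖x i j‖ ^ 2) (rayleigh r c) :=
  integrable_finsetSum _ fun i _ => (measurePreserving_eval
    (fun _ : Fin r => complexGaussianVec c 1) i).integrable_comp_of_integrable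
      (integrable_sum_norm_sq c 1)

/-! ### Log-determinants of positive definite matrices -/

section Matrices

open scoped ComplexOrder MatrixOrder

lemma posSemidef_smul_mul_conjTranspose {m n : Type*} [Fintype m] [Fintype n] {c : ℝ} (hc : 0 ≤ c)
    (A : Matrix m n ℂ) :
    ((c : ℂ) • (A * Aᴴ)).PosSemidef :=
  (Matrix.posSemidef_self_mul_conjTranspose A).smul (by exact_mod_cast hc)

variable {l m n : Type*} [Fintype l] [Fintype m] [Fintype n] [DecidableEq m]

/-- The capacity `log det (1 + c A Aᴴ)`, in nats, of the channel `A` at signal-to-noise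
ratio `c`. -/
noncomputable def logDet (c : ℝ) (A : Matrix m n ℂ) : ℝ :=
  Real.log (Matrix.det (1 + (c : ℂ) • (A * Aᴴ))).re

lemma posDef_one_add {c : ℝ} (hc : 0 ≤ c) (A : Matrix m n ℂ) :
    (1 + (c : ℂ) • (A * Aᴴ)).PosDef :=
  Matrix.PosDef.one.add_posSemidef (posSemidef_smul_mul_conjTranspose hc A)

lemma re_det_pos {A : Matrix m m ℂ} (hA : A.PosDef) : 0 < A.det.re :=
  (Complex.pos_iff.1 hA.det_pos).1

lemma exists_eq_mul_conjTranspose {A : Matrix m m ℂ} (hA : A.PosDef) :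
    ∃ S : Matrix m m ℂ, IsUnit S.det ∧ S * Sᴴ = A := by
  obtain ⟨B, hB⟩ := CStarAlgebra.nonneg_iff_eq_star_mul_self.mp hA.posSemidef.nonneg
  rw [Matrix.star_eq_conjTranspose] at hB
  refine ⟨Bᴴ, ?_, by rw [Matrix.conjTranspose_conjTranspose, hB]⟩
  have h := hA.det_pos.ne'
  rw [hB, Matrix.det_mul] at h
  exact (left_ne_zero_of_mul h).isUnit

lemma re_det_eq_prod_eigenvalues {A : Matrix m m ℂ} (hA : A.IsHermitian) :
    A.det.re = ∏ i, hA.eigenvalues i := by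
  rw [hA.det_eq_prod_eigenvalues, ← RCLike.ofReal_prod]
  exact RCLike.ofReal_re (K := ℂ) _

lemma re_trace_eq_sum_eigenvalues {A : Matrix m m ℂ} (hA : A.IsHermitian) :
    A.trace.re = ∑ i, hA.eigenvalues i := by
  rw [hA.trace_eq_sum_eigenvalues, ← RCLike.ofReal_sum]
  exact RCLike.ofReal_re (K := ℂ) _

lemma det_one_add_ge_one {P : Matrix m m ℂ} (hP : P.PosSemidef) :
    1 ≤ (Matrix.det (1 + P)).re := by
  have h1 : (1 + P).PosDef := Matrix.PosDef.one.add_posSemidef hP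
  rw [re_det_eq_prod_eigenvalues h1.1]
  refine Finset.one_le_prod fun i _ => ?_
  rw [h1.1.eigenvalues_eq, Matrix.add_mulVec, Matrix.one_mulVec, dotProduct_add, map_add]
  have h2 := hP.re_dotProduct_nonneg ((h1.1.eigenvectorBasis i).ofLp)
  have h3 : RCLike.re (star (h1.1.eigenvectorBasis i).ofLp ⬝ᵥ (h1.1.eigenvectorBasis i).ofLp)
      = (1 : ℝ) := by
    have h4 := h1.1.eigenvectorBasis.orthonormal.1 i
    rw [dotProduct_comm, ← EuclideanSpace.inner_eq_star_dotProduct, inner_self_eq_norm_sq_to_K, h4]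
    simp
  exact h3.ge.trans (le_add_of_nonneg_right h2)

lemma re_det_le_re_det_add {A P : Matrix m m ℂ} (hA : A.PosDef) (hP : P.PosSemidef) :
    A.det.re ≤ (A + P).det.re := by
  obtain ⟨S, hS, rfl⟩ := exists_eq_mul_conjTranspose hA
  have hSH : IsUnit Sᴴ.det := by rw [Matrix.det_conjTranspose]; exact hS.star
  have h1 : S * Sᴴ + P = S * (1 + S⁻¹ * P * S⁻¹ᴴ) * Sᴴ := by
    have : S⁻¹ᴴ * Sᴴ = 1 := by
      rw [← Matrix.conjTranspose_mul, Matrix.mul_nonsing_inv _ hS, Matrix.conjTranspose_one]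
    rw [Matrix.mul_add, Matrix.add_mul, Matrix.mul_one]
    congr 1
    rw [Matrix.mul_assoc, Matrix.mul_assoc, Matrix.mul_assoc, this, Matrix.mul_one,
      ← Matrix.mul_assoc, Matrix.mul_nonsing_inv _ hS, Matrix.one_mul]
  have h2 := det_one_add_ge_one (hP.mul_mul_conjTranspose_same S⁻¹)
  have h3 : (S * (1 + S⁻¹ * P * S⁻¹ᴴ) * Sᴴ).det =
      (Complex.normSq S.det : ℂ) * (1 + S⁻¹ * P * S⁻¹ᴴ).det := by
    rw [Matrix.det_mul, Matrix.det_mul, Matrix.det_conjTranspose, Complex.normSq_eq_conj_mul_self]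
    simp only [RCLike.star_def]
    ring
  rw [h1, h3, Complex.re_ofReal_mul, Matrix.det_mul, Matrix.det_conjTranspose, RCLike.star_def,
    Complex.mul_conj, Complex.ofReal_re]
  exact le_mul_of_one_le_right (Complex.normSq_nonneg _) h2

lemma logDet_le_logDet_of_posSemidef {c d : ℝ} (hc : 0 ≤ c)
    {A : Matrix m n ℂ} {B : Matrix m l ℂ}
    (h : ((d : ℂ) • (B * Bᴴ) - (c : ℂ) • (A * Aᴴ)).PosSemidef) : logDet c A ≤ logDet d B := by
  have h1 := re_det_le_re_det_add (posDef_one_add hc A) h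
  rw [add_add_sub_cancel] at h1
  exact Real.log_le_log (re_det_pos (posDef_one_add hc A)) h1

lemma logDet_conjTranspose [DecidableEq n] (c : ℝ) (A : Matrix m n ℂ) :
    logDet c Aᴴ = logDet c A := by
  rw [logDet, logDet, Matrix.conjTranspose_conjTranspose, ← Matrix.smul_mul,
    Matrix.det_one_add_mul_comm, Matrix.mul_smul]

lemma logDet_transpose [DecidableEq n] (c : ℝ) (A : Matrix m n ℂ) : logDet c Aᵀ = logDet c A := by
  rw [← logDet_conjTranspose c A, logDet, logDet, ← Matrix.det_transpose,
    Matrix.conjTranspose_conjTranspose]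
  congr 3
  rw [Matrix.transpose_add, Matrix.transpose_one, Matrix.transpose_smul, Matrix.transpose_mul,
    Matrix.transpose_transpose]
  rfl

lemma logDet_le {c : ℝ} (hc : 0 ≤ c) (A : Matrix m n ℂ) :
    logDet c A ≤ c * ∑ i, ∑ j, ‖A i j‖ ^ 2 := by
  have h1 := posDef_one_add hc A
  have h2 : (Matrix.trace (1 + (c : ℂ) • (A * Aᴴ))).re =
      Fintype.card m + c * ∑ i, ∑ j, ‖A i j‖ ^ 2 := by
    rw [Matrix.trace_add, Matrix.trace_one, Matrix.trace_smul, Matrix.trace_mul_comm, smul_eq_mul,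
      Complex.add_re, Complex.re_ofReal_mul, Complex.natCast_re]
    congr 2
    simp only [Matrix.trace, Matrix.diag_apply, Matrix.mul_apply, Matrix.conjTranspose_apply,
      Complex.re_sum]
    rw [Finset.sum_comm]
    refine Finset.sum_congr rfl fun i _ => Finset.sum_congr rfl fun j _ => ?_
    rw [Complex.sq_norm, Complex.normSq_apply]
    simp
  rw [re_trace_eq_sum_eigenvalues h1.1] at h2
  rw [logDet, re_det_eq_prod_eigenvalues h1.1, Real.log_prod fun i _ => (h1.eigenvalues_pos i).ne']
  calc ∑ i, Real.log (h1.1.eigenvalues i) ≤ ∑ i, (h1.1.eigenvalues i - 1) :=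
        Finset.sum_le_sum fun i _ => Real.log_le_sub_one_of_pos (h1.eigenvalues_pos i)
    _ = c * ∑ i, ∑ j, ‖A i j‖ ^ 2 := by
        rw [Finset.sum_sub_distrib, h2]
        simp

/-- A matrix with orthonormal rows is a contraction: `1 - Eᴴ E` is an orthogonal projection. -/
lemma posSemidef_one_sub [DecidableEq n] {E : Matrix m n ℂ} (hE : E * Eᴴ = 1) :
    (1 - Eᴴ * E).PosSemidef := by
  have h : 1 - Eᴴ * E = (1 - Eᴴ * E)ᴴ * (1 - Eᴴ * E) := by
    have h2 : Eᴴ * E * (Eᴴ * E) = Eᴴ * E := by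
      rw [Matrix.mul_assoc, ← Matrix.mul_assoc E, hE, Matrix.one_mul]
    rw [Matrix.conjTranspose_sub, Matrix.conjTranspose_one, Matrix.conjTranspose_mul,
      Matrix.conjTranspose_conjTranspose, Matrix.sub_mul, Matrix.mul_sub, Matrix.mul_sub, h2]
    simp
  rw [h]
  exact Matrix.posSemidef_conjTranspose_mul_self _

/-- Discarding the part of the received signal outside the rows of `E`, and lowering the
signal-to-noise ratio, does not increase the capacity. -/
lemma logDet_mul_le [DecidableEq l] [DecidableEq n] {c d : ℝ} (hc : 0 ≤ c) (hcd : c ≤ d)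
    {E : Matrix l m ℂ} (hE : E * Eᴴ = 1)
    (A : Matrix m n ℂ) : logDet c (E * A) ≤ logDet d A := by
  rw [← logDet_conjTranspose c, ← logDet_conjTranspose d]
  refine logDet_le_logDet_of_posSemidef hc ?_
  have h1 := ((posSemidef_one_sub hE).conjTranspose_mul_mul_same A).smul
    (show (0 : ℂ) ≤ (c : ℂ) by exact_mod_cast hc)
  have h2 := (Matrix.posSemidef_conjTranspose_mul_self A).smul
    (show (0 : ℂ) ≤ ((d - c : ℝ) : ℂ) by exact_mod_cast sub_nonneg.2 hcd)
  convert h2.add h1 using 1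
  simp only [Matrix.conjTranspose_conjTranspose, Matrix.conjTranspose_mul, Matrix.mul_sub,
    Matrix.sub_mul, Matrix.mul_one, Matrix.mul_assoc]
  rw [Complex.ofReal_sub, sub_smul, smul_sub]
  abel

end Matrices

/-! ### Mutual information of a linear Gaussian channel -/

lemma measurable_mulVec {m n : Type*} [Fintype m] [Fintype n] (A : Matrix m n ℂ) :
    Measurable (fun x : n → ℂ => A *ᵥ x) :=
  (by fun_prop : Continuous fun x : n → ℂ => A *ᵥ x).measurable

lemma star_dotProduct_self_re {n : Type*} [Fintype n] (a : n → ℂ) :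
    (star a ⬝ᵥ a).re = ∑ i, ‖a i‖ ^ 2 := by
  rw [dotProduct, Complex.re_sum]
  refine Finset.sum_congr rfl fun i _ => ?_
  rw [Complex.sq_norm, Complex.normSq_apply]
  simp

lemma star_dotProduct_mulVec {m n : Type*} [Fintype m] [Fintype n] (D : Matrix m n ℂ)
    (a : m → ℂ) (x : n → ℂ) : star a ⬝ᵥ (D *ᵥ x) = star (Dᴴ *ᵥ a) ⬝ᵥ x := by
  rw [Matrix.dotProduct_mulVec, Matrix.star_mulVec, Matrix.conjTranspose_conjTranspose]

lemma integral_exp_mulVec {m q : ℕ} (v : ℝ≥0) (D : Matrix (Fin q) (Fin m) ℂ) (a : Fin q → ℂ) :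
    ∫ x, Complex.exp ((star a ⬝ᵥ (D *ᵥ x)).re * Complex.I) ∂(complexGaussianVec m v)
      = Complex.exp (-(v / 4 * (star a ⬝ᵥ ((D * Dᴴ) *ᵥ a)).re : ℝ)) := by
  simp_rw [star_dotProduct_mulVec D]
  rw [integral_exp_vec, ← star_dotProduct_self_re, ← star_dotProduct_mulVec D,
    Matrix.mulVec_mulVec]

lemma continuous_exp_dotProduct {q : ℕ} (a : Fin q → ℂ) :
    Continuous fun x : Fin q → ℂ => Complex.exp ((star a ⬝ᵥ x).re * Complex.I) := by
  fun_prop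

/-- Projecting white Gaussian noise on orthonormal rows gives white Gaussian noise. -/
lemma map_mulVec_complexGaussianVec {m q : ℕ} (v : ℝ≥0) {D : Matrix (Fin q) (Fin m) ℂ}
    (hD : D * Dᴴ = 1) :
    (complexGaussianVec m v).map (fun x => D *ᵥ x) = complexGaussianVec q v := by
  have := Measure.isProbabilityMeasure_map (μ := complexGaussianVec m v)
    (measurable_mulVec D).aemeasurable
  refine ext_of_integral_exp fun a => ?_
  rw [integral_map (measurable_mulVec D).aemeasurable
    (continuous_exp_dotProduct a).aestronglyMeasurable, integral_exp_mulVec, integral_exp_vec, hD,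
    Matrix.one_mulVec, star_dotProduct_self_re]

/-- The output of a linear Gaussian channel is a Gaussian vector with covariance `S Sᴴ`. -/
lemma map_output_eq {k q : ℕ} (v w : ℝ≥0) (A : Matrix (Fin q) (Fin k) ℂ)
    (S : Matrix (Fin q) (Fin q) ℂ)
    (hS : S * Sᴴ = ((w : ℝ) : ℂ) • (1 : Matrix (Fin q) (Fin q) ℂ) + ((v : ℝ) : ℂ) • (A * Aᴴ)) :
    ((complexGaussianVec k v).prod (complexGaussianVec q w)).map (fun p => A *ᵥ p.1 + p.2) =
      (complexGaussianVec q 1).map (fun x => S *ᵥ x) := by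
  have hm : Measurable fun p : (Fin k → ℂ) × (Fin q → ℂ) => A *ᵥ p.1 + p.2 :=
    ((measurable_mulVec A).comp measurable_fst).add measurable_snd
  have := Measure.isProbabilityMeasure_map (μ := complexGaussianVec q 1)
    (measurable_mulVec S).aemeasurable
  have := Measure.isProbabilityMeasure_map
    (μ := (complexGaussianVec k v).prod (complexGaussianVec q w)) hm.aemeasurable
  refine ext_of_integral_exp fun a => ?_
  rw [integral_map (measurable_mulVec S).aemeasurable
    (continuous_exp_dotProduct a).aestronglyMeasurable, integral_exp_mulVec,
    integral_map hm.aemeasurable (continuous_exp_dotProduct a).aestronglyMeasurable]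
  simp_rw [dotProduct_add, Complex.add_re, Complex.ofReal_add, add_mul, Complex.exp_add]
  rw [integral_prod_mul (fun x => Complex.exp ((star a ⬝ᵥ (A *ᵥ x)).re * Complex.I))
    (fun x => Complex.exp ((star a ⬝ᵥ x).re * Complex.I)), integral_exp_mulVec, integral_exp_vec,
    ← Complex.exp_add, hS, Matrix.add_mulVec, dotProduct_add, Matrix.smul_mulVec,
    Matrix.smul_mulVec, Matrix.one_mulVec, dotProduct_smul, dotProduct_smul, smul_eq_mul,
    smul_eq_mul, Complex.add_re, Complex.re_ofReal_mul, Complex.re_ofReal_mul,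
    star_dotProduct_self_re]
  congr 1
  push_cast
  ring

lemma map_withDensity_comp {α β : Type*} [MeasurableSpace α] [MeasurableSpace β] (μ : Measure α)
    {f : α → β} (hf : Measurable f) {h : β → ℝ≥0∞} (hh : Measurable h) :
    (μ.withDensity (fun x => h (f x))).map f = (μ.map f).withDensity h := by
  ext s hs
  rw [Measure.map_apply hf hs, withDensity_apply _ (hf hs), withDensity_apply _ hs,
    setLIntegral_map hs hh hf]

lemma map_mulVec_volume {q : ℕ} {S : Matrix (Fin q) (Fin q) ℂ} (hS : IsUnit S.det) :
    (volume : Measure (Fin q → ℂ)).map (fun x => S *ᵥ x) =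
      ENNReal.ofReal (Complex.normSq S.det)⁻¹ • volume := by
  have h1 : LinearMap.det ((Matrix.toLin' S).restrictScalars ℝ) = Complex.normSq S.det := by
    rw [LinearMap.det_restrictScalars, LinearMap.det_toLin', Algebra.norm_complex_apply]
  have h2 := Measure.map_linearMap_addHaar_eq_smul_addHaar (volume : Measure (Fin q → ℂ))
    (f := (Matrix.toLin' S).restrictScalars ℝ)
    (by rw [h1]; exact (Complex.normSq_pos.2 hS.ne_zero).ne')
  rw [h1, abs_of_nonneg (inv_nonneg.2 (Complex.normSq_nonneg _))] at h2
  exact h2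

/-- The Lebesgue density of the image of `CN(0, I)` under the invertible matrix `S`. -/
noncomputable def imageDensity {q : ℕ} (S : Matrix (Fin q) (Fin q) ℂ) (y : Fin q → ℂ) : ℝ :=
  (Complex.normSq S.det)⁻¹ * gaussianDensity q 1 (S⁻¹ *ᵥ y)

lemma imageDensity_pos {q : ℕ} {S : Matrix (Fin q) (Fin q) ℂ} (hS : IsUnit S.det)
    (y : Fin q → ℂ) : 0 < imageDensity S y :=
  mul_pos (inv_pos.2 (Complex.normSq_pos.2 hS.ne_zero)) (gaussianDensity_pos one_pos _)

lemma measurable_imageDensity {q : ℕ} (S : Matrix (Fin q) (Fin q) ℂ) :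
    Measurable (imageDensity S) :=
  ((measurable_gaussianDensity q 1).comp (measurable_mulVec _)).const_mul _

lemma map_mulVec_eq_withDensity {q : ℕ} {S : Matrix (Fin q) (Fin q) ℂ} (hS : IsUnit S.det) :
    (complexGaussianVec q 1).map (fun x => S *ᵥ x) =
      volume.withDensity (fun y => ENNReal.ofReal (imageDensity S y)) := by
  have h1 : (fun x => ENNReal.ofReal (gaussianDensity q 1 x)) =
      fun x => ENNReal.ofReal (gaussianDensity q 1 (S⁻¹ *ᵥ (S *ᵥ x))) := by
    funext x
    rw [Matrix.mulVec_mulVec, Matrix.nonsing_inv_mul _ hS, Matrix.one_mulVec]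
  have hm : Measurable fun y => ENNReal.ofReal (gaussianDensity q 1 (S⁻¹ *ᵥ y)) :=
    ((measurable_gaussianDensity q 1).comp (measurable_mulVec _)).ennreal_ofReal
  rw [complexGaussianVec_eq_withDensity one_pos, h1,
    map_withDensity_comp _ (measurable_mulVec S) hm, map_mulVec_volume hS,
    withDensity_smul_measure, ← withDensity_smul _ hm]
  congr 1
  funext y
  rw [imageDensity, ENNReal.ofReal_mul (inv_nonneg.2 (Complex.normSq_nonneg _))]
  rfl

section Channel

variable {k q : ℕ}

/-- The input and the output of the channel `y = A s + n`, as a function of `(s, n)`. -/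
def shear (A : Matrix (Fin q) (Fin k) ℂ) (p : (Fin k → ℂ) × (Fin q → ℂ)) :
    (Fin k → ℂ) × (Fin q → ℂ) := (p.1, A *ᵥ p.1 + p.2)

lemma measurable_shear (A : Matrix (Fin q) (Fin k) ℂ) : Measurable (shear A) :=
  measurable_fst.prodMk (((measurable_mulVec A).comp measurable_fst).add measurable_snd)

/-- The joint law of input and output of a linear Gaussian channel has an explicit density with
respect to the product of the law of the input and a Gaussian law. -/
lemma map_shear_eq_withDensity (v : ℝ≥0) {w : ℝ≥0} (hw : 0 < w) (A : Matrix (Fin q) (Fin k) ℂ)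
    {S : Matrix (Fin q) (Fin q) ℂ} (hS : IsUnit S.det) :
    ((complexGaussianVec k v).prod (complexGaussianVec q w)).map (shear A) =
      ((complexGaussianVec k v).prod
        ((complexGaussianVec q 1).map (fun x => S *ᵥ x))).withDensity
        (fun p => ENNReal.ofReal (gaussianDensity q w (p.2 - A *ᵥ p.1) / imageDensity S p.2)) := by
  have hA : Measurable fun p : (Fin k → ℂ) × (Fin q → ℂ) => p.2 - A *ᵥ p.1 :=
    measurable_snd.sub ((measurable_mulVec A).comp measurable_fst)
  have hg : Measurable fun p : (Fin k → ℂ) × (Fin q → ℂ) =>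
      ENNReal.ofReal (gaussianDensity q w (p.2 - A *ᵥ p.1)) :=
    ((measurable_gaussianDensity q w).comp hA).ennreal_ofReal
  have hi : Measurable fun y => ENNReal.ofReal (imageDensity S y) :=
    (measurable_imageDensity S).ennreal_ofReal
  have hσ : SFinite (volume.withDensity fun y => ENNReal.ofReal (imageDensity S y)) := by
    rw [← map_mulVec_eq_withDensity hS]; infer_instance
  have hmp : MeasurePreserving (shear A) ((complexGaussianVec k v).prod volume)
      ((complexGaussianVec k v).prod volume) :=
    (MeasurePreserving.id _).skew_product (g := fun s n => A *ᵥ s + n)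
      (((measurable_mulVec A).comp measurable_fst).add measurable_snd)
      (Filter.Eventually.of_forall fun s => map_add_left_eq_self volume (A *ᵥ s))
  have hσ' : SFinite (volume.withDensity fun x : Fin q → ℂ =>
      ENNReal.ofReal (gaussianDensity q w x)) := by
    rw [← complexGaussianVec_eq_withDensity hw]; infer_instance
  have h1 : (fun p : (Fin k → ℂ) × (Fin q → ℂ) => ENNReal.ofReal (gaussianDensity q w p.2)) =
      fun p => ENNReal.ofReal
        (gaussianDensity q w ((shear A p).2 - A *ᵥ (shear A p).1)) := by
    funext p
    simp [shear]
  rw [map_mulVec_eq_withDensity hS, complexGaussianVec_eq_withDensity hw,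
    prod_withDensity_right (measurable_gaussianDensity q w).ennreal_ofReal,
    prod_withDensity_right hi, h1, map_withDensity_comp _ (measurable_shear A) hg, hmp.map_eq,
    ← withDensity_mul _
      (f := fun p : (Fin k → ℂ) × (Fin q → ℂ) => ENNReal.ofReal (imageDensity S p.2))
      (g := fun p => ENNReal.ofReal (gaussianDensity q w (p.2 - A *ᵥ p.1) / imageDensity S p.2))
      (hi.comp measurable_snd) (Measurable.ennreal_ofReal
      (((measurable_gaussianDensity q w).comp hA).div
        ((measurable_imageDensity S).comp measurable_snd)))]
  congr 1
  funext p
  have hp := imageDensity_pos hS p.2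
  rw [Pi.mul_apply, ← ENNReal.ofReal_mul hp.le, mul_div_cancel₀ _ hp.ne']

lemma log_density_ratio {w : ℝ≥0} (hw : 0 < w) {S : Matrix (Fin q) (Fin q) ℂ}
    (hS : IsUnit S.det) (x y : Fin q → ℂ) :
    Real.log (gaussianDensity q w x / imageDensity S y) =
      Real.log (Complex.normSq S.det) - q * Real.log w - (∑ i, ‖x i‖ ^ 2) / w
        + ∑ i, ‖(S⁻¹ *ᵥ y) i‖ ^ 2 := by
  have hw' : (0 : ℝ) < w := hw
  have hd := Complex.normSq_pos.2 hS.ne_zero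
  rw [Real.log_div (gaussianDensity_pos hw x).ne' (imageDensity_pos hS y).ne', imageDensity,
    Real.log_mul (by positivity) (gaussianDensity_pos one_pos _).ne', gaussianDensity,
    gaussianDensity, Real.log_mul (by positivity) (by positivity),
    Real.log_mul (by positivity) (by positivity), Real.log_exp, Real.log_exp, Real.log_pow,
    Real.log_pow, Real.log_inv, Real.log_inv, Real.log_inv,
    Real.log_mul Real.pi_pos.ne' hw'.ne']
  simp
  ring

/-- The mutual information of a linear Gaussian channel, as a Kullback-Leibler divergence. -/
lemma klDiv_shear (v : ℝ≥0) {w : ℝ≥0} (hw : 0 < w) (A : Matrix (Fin q) (Fin k) ℂ) :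
    klDiv (((complexGaussianVec k v).prod (complexGaussianVec q w)).map (shear A))
      ((complexGaussianVec k v).prod
        (((complexGaussianVec k v).prod (complexGaussianVec q w)).map
          (fun p => A *ᵥ p.1 + p.2))) = ENNReal.ofReal (logDet (v / w) A) := by
  have hw' : (0 : ℝ) < w := hw
  have hwc : ((w : ℝ) : ℂ) ≠ 0 := by exact_mod_cast hw'.ne'
  have hpd := posDef_one_add (c := (v : ℝ) / w) (by positivity) A
  have hcov : ((w : ℝ) : ℂ) • (1 + (((v : ℝ) / w : ℝ) : ℂ) • (A * Aᴴ)) =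
      ((w : ℝ) : ℂ) • (1 : Matrix (Fin q) (Fin q) ℂ) + ((v : ℝ) : ℂ) • (A * Aᴴ) := by
    rw [smul_add, smul_smul]
    congr 2
    push_cast
    field_simp
  open ComplexOrder in
  obtain ⟨S, hS, hSS⟩ := exists_eq_mul_conjTranspose
    (hpd.smul (show (0 : ℂ) < ((w : ℝ) : ℂ) by exact_mod_cast hw'))
  have hdet : Real.log (Complex.normSq S.det) - q * Real.log w = logDet (v / w) A := by
    have h1 : (Complex.normSq S.det : ℂ) =
        (((w : ℝ) ^ q : ℝ) : ℂ) * (1 + (((v : ℝ) / w : ℝ) : ℂ) • (A * Aᴴ)).det := by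
      have h2 := congrArg Matrix.det hSS
      rw [Matrix.det_smul, Fintype.card_fin, Matrix.det_mul, Matrix.det_conjTranspose] at h2
      rw [Complex.ofReal_pow, ← h2, Complex.normSq_eq_conj_mul_self, mul_comm]
      rfl
    have h2 := congrArg Complex.re h1
    rw [Complex.ofReal_re, Complex.re_ofReal_mul] at h2
    rw [h2, Real.log_mul (by positivity) (re_det_pos hpd).ne', Real.log_pow, logDet]
    ring
  have hlaw := map_output_eq v w A S (hSS.trans hcov)
  set μ := complexGaussianVec k v with hμ
  set ν := complexGaussianVec q w with hν
  set N := (complexGaussianVec q 1).map (fun x => S *ᵥ x) with hN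
  have hJ := map_shear_eq_withDensity v hw A hS
  rw [← hμ, ← hν, ← hN] at hJ
  have hNp : IsProbabilityMeasure N :=
    Measure.isProbabilityMeasure_map (measurable_mulVec S).aemeasurable
  have hJp : IsProbabilityMeasure ((μ.prod ν).map (shear A)) :=
    Measure.isProbabilityMeasure_map (measurable_shear A).aemeasurable
  rw [hlaw]
  have hr : Measurable fun p : (Fin k → ℂ) × (Fin q → ℂ) =>
      ENNReal.ofReal (gaussianDensity q w (p.2 - A *ᵥ p.1) / imageDensity S p.2) :=
    Measurable.ennreal_ofReal (((measurable_gaussianDensity q w).comp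
      (measurable_snd.sub ((measurable_mulVec A).comp measurable_fst))).div
        ((measurable_imageDensity S).comp measurable_snd))
  have hac : (μ.prod ν).map (shear A) ≪ μ.prod N := by
    rw [hJ]; exact withDensity_absolutelyContinuous _ _
  have hllr : llr ((μ.prod ν).map (shear A)) (μ.prod N) =ᵐ[(μ.prod ν).map (shear A)]
      fun p => logDet (v / w) A - (∑ i, ‖(p.2 - A *ᵥ p.1) i‖ ^ 2) / w
        + ∑ i, ‖(S⁻¹ *ᵥ p.2) i‖ ^ 2 := by
    have h1 := hac.ae_le (Measure.rnDeriv_withDensity (μ.prod N) hr)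
    rw [← hJ] at h1
    filter_upwards [h1] with p hp
    rw [llr, hp, ENNReal.toReal_ofReal
      (div_pos (gaussianDensity_pos hw _) (imageDensity_pos hS _)).le, log_density_ratio hw hS,
      hdet]
  -- The two quadratic forms are squared norms of standard Gaussian vectors, so that their
  -- expectations cancel.
  have hi1 : Integrable (fun p : (Fin k → ℂ) × (Fin q → ℂ) => (∑ i, ‖p.2 i‖ ^ 2) / (w : ℝ))
      (μ.prod ν) := ((integrable_sum_norm_sq q w).div_const _).comp_snd μ
  have hsm : Measurable fun y : Fin q → ℂ => ∑ i, ‖(S⁻¹ *ᵥ y) i‖ ^ 2 :=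
    (by fun_prop : Measurable fun y : Fin q → ℂ => ∑ i, ‖y i‖ ^ 2).comp (measurable_mulVec S⁻¹)
  have hcancel : (fun x : Fin q → ℂ => ∑ i, ‖(S⁻¹ *ᵥ (S *ᵥ x)) i‖ ^ 2) =
      fun x => ∑ i, ‖x i‖ ^ 2 := by
    funext x
    rw [Matrix.mulVec_mulVec, Matrix.nonsing_inv_mul _ hS, Matrix.one_mulVec]
  have hym : Measurable fun p : (Fin k → ℂ) × (Fin q → ℂ) => A *ᵥ p.1 + p.2 :=
    ((measurable_mulVec A).comp measurable_fst).add measurable_snd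
  have hi2' : Integrable (fun y => ∑ i, ‖(S⁻¹ *ᵥ y) i‖ ^ 2) N := by
    rw [hN, integrable_map_measure hsm.aestronglyMeasurable (measurable_mulVec S).aemeasurable]
    change Integrable (fun x : Fin q → ℂ => ∑ i, ‖(S⁻¹ *ᵥ (S *ᵥ x)) i‖ ^ 2) _
    rw [hcancel]
    exact integrable_sum_norm_sq q 1
  have hi2 : Integrable (fun p : (Fin k → ℂ) × (Fin q → ℂ) =>
      ∑ i, ‖(S⁻¹ *ᵥ (A *ᵥ p.1 + p.2)) i‖ ^ 2) (μ.prod ν) := by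
    rw [← hlaw, integrable_map_measure hsm.aestronglyMeasurable hym.aemeasurable] at hi2'
    exact hi2'
  have he2 : ∫ p, ∑ i, ‖(S⁻¹ *ᵥ (A *ᵥ p.1 + p.2)) i‖ ^ 2 ∂(μ.prod ν) = q := by
    rw [← integral_map (f := fun y => ∑ i, ‖(S⁻¹ *ᵥ y) i‖ ^ 2) hym.aemeasurable
      hsm.aestronglyMeasurable, hlaw, hN, integral_map (measurable_mulVec S).aemeasurable
      hsm.aestronglyMeasurable, hcancel, integral_sum_norm_sq]
    simp
  have he1 : ∫ p : (Fin k → ℂ) × (Fin q → ℂ), (∑ i, ‖p.2 i‖ ^ 2) / (w : ℝ) ∂(μ.prod ν) = q := by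
    rw [integral_fun_snd (fun x : Fin q → ℂ => (∑ i, ‖x i‖ ^ 2) / (w : ℝ)), integral_div,
      integral_sum_norm_sq]
    simp [hw'.ne']
  have hqm : Measurable fun p : (Fin k → ℂ) × (Fin q → ℂ) =>
      logDet (v / w) A - (∑ i, ‖(p.2 - A *ᵥ p.1) i‖ ^ 2) / w + ∑ i, ‖(S⁻¹ *ᵥ p.2) i‖ ^ 2 := by
    refine (measurable_const.sub (Measurable.div_const ?_ _)).add (hsm.comp measurable_snd)
    exact (by fun_prop : Measurable fun y : Fin q → ℂ => ∑ i, ‖y i‖ ^ 2).comp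
      (measurable_snd.sub ((measurable_mulVec A).comp measurable_fst))
  have hcomp : (fun p : (Fin k → ℂ) × (Fin q → ℂ) =>
      logDet (v / w) A - (∑ i, ‖((shear A p).2 - A *ᵥ (shear A p).1) i‖ ^ 2) / w
        + ∑ i, ‖(S⁻¹ *ᵥ (shear A p).2) i‖ ^ 2) =
      fun p => logDet (v / w) A - (∑ i, ‖p.2 i‖ ^ 2) / w
        + ∑ i, ‖(S⁻¹ *ᵥ (A *ᵥ p.1 + p.2)) i‖ ^ 2 := by
    funext p
    simp [shear]
  have hint : Integrable (llr ((μ.prod ν).map (shear A)) (μ.prod N))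
      ((μ.prod ν).map (shear A)) := by
    rw [integrable_congr hllr, integrable_map_measure hqm.aestronglyMeasurable
      (measurable_shear A).aemeasurable]
    refine Integrable.congr (((integrable_const (logDet (v / w) A)).sub hi1).add hi2) ?_
    exact (Filter.EventuallyEq.of_eq hcomp).symm
  have hi3 : Integrable (fun p : (Fin k → ℂ) × (Fin q → ℂ) =>
      logDet (v / w) A - (∑ i, ‖p.2 i‖ ^ 2) / (w : ℝ)) (μ.prod ν) := (integrable_const _).sub hi1
  rw [klDiv_of_ac_of_integrable hac hint, integral_congr_ae hllr,
    integral_map (measurable_shear A).aemeasurable hqm.aestronglyMeasurable, hcomp,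
    integral_add hi3 hi2, integral_sub (integrable_const _) hi1, he1,
    he2]
  simp

end Channel

/-- The mutual information, in bits, between the Gaussian signal `s` and the output
`A s + D u` of a channel that removes the artificial noise `r` and whose noise `D u` is white. -/
lemma mutualInfo_eq {k j m q : ℕ} (v ρ : ℝ≥0) {w : ℝ≥0} (hw : 0 < w)
    (A : Matrix (Fin q) (Fin k) ℂ) {D : Matrix (Fin q) (Fin m) ℂ} (hD : D * Dᴴ = 1)
    (Y : (Fin k → ℂ) × (Fin j → ℂ) × (Fin m → ℂ) → Fin q → ℂ)
    (hY : ∀ ω, Y ω = A *ᵥ ω.1 + D *ᵥ ω.2.2) :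
    mutualInfo ((complexGaussianVec k v).prod
        ((complexGaussianVec j ρ).prod (complexGaussianVec m w))) (fun ω => ω.1) Y
      = ENNReal.ofReal (logDet (v / w) A) / ENNReal.ofReal (Real.log 2) := by
  obtain rfl : Y = fun ω => A *ᵥ ω.1 + D *ᵥ ω.2.2 := funext hY
  have hmp : MeasurePreserving (fun ω : (Fin k → ℂ) × (Fin j → ℂ) × (Fin m → ℂ) =>
      (ω.1, D *ᵥ ω.2.2))
      ((complexGaussianVec k v).prod ((complexGaussianVec j ρ).prod (complexGaussianVec m w)))
      ((complexGaussianVec k v).prod (complexGaussianVec q w)) :=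
    (MeasurePreserving.id _).prod (MeasurePreserving.comp
      ⟨measurable_mulVec D, map_mulVec_complexGaussianVec w hD⟩ measurePreserving_snd)
  have h1 := Measure.map_map (measurable_shear A) hmp.measurable
    (μ := (complexGaussianVec k v).prod ((complexGaussianVec j ρ).prod (complexGaussianVec m w)))
  have h2 := Measure.map_map (g := fun p : (Fin k → ℂ) × (Fin q → ℂ) => A *ᵥ p.1 + p.2)
    (((measurable_mulVec A).comp measurable_fst).add measurable_snd) hmp.measurable
    (μ := (complexGaussianVec k v).prod ((complexGaussianVec j ρ).prod (complexGaussianVec m w)))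
  rw [hmp.map_eq] at h1 h2
  rw [mutualInfo, ← klDiv_shear v hw A, h1, h2]
  congr 3
  exact measurePreserving_fst.map_eq

/-! ### Right singular vectors and elimination of the artificial noise -/

section Precoding

variable {Na Nb : ℕ} {H : Matrix (Fin Nb) (Fin Na) ℂ}
  {V : Matrix (Fin Na) (Fin Nb ⊕ Fin (Na - Nb)) ℂ}

lemma toCols₁_mul_add (hV : V * Vᴴ = 1) :
    V.toCols₁ * V.toCols₁ᴴ + V.toCols₂ * V.toCols₂ᴴ = 1 := by
  rw [← hV]
  conv_rhs => rw [← Matrix.fromCols_toCols V]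
  rw [Matrix.conjTranspose_fromCols_eq_fromRows_conjTranspose, Matrix.fromCols_mul_fromRows]

lemma conjTranspose_toCols_mul (hV : Vᴴ * V = 1) :
    V.toCols₁ᴴ * V.toCols₁ = 1 ∧ V.toCols₁ᴴ * V.toCols₂ = 0 ∧
      V.toCols₂ᴴ * V.toCols₁ = 0 ∧ V.toCols₂ᴴ * V.toCols₂ = 1 := by
  rw [← Matrix.fromCols_toCols V, Matrix.conjTranspose_fromCols_eq_fromRows_conjTranspose,
    Matrix.fromRows_mul_fromCols, ← Matrix.fromBlocks_one, Matrix.fromBlocks_inj] at hV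
  exact hV

/-- The artificial noise is sent in the null space of `H`. -/
lemma IsRightSingular.mul_toCols₂ (h : IsRightSingular H V) : H * V.toCols₂ = 0 := by
  obtain ⟨h1, -, U, Λ, -, -, hH⟩ := h
  have h2 : H * V = U * Matrix.fromCols (Matrix.diagonal fun i => (Λ i : ℂ)) 0 := by
    rw [hH, Matrix.mul_assoc, h1, Matrix.mul_one]
  rw [← Matrix.fromCols_toCols V, Matrix.mul_fromCols, Matrix.mul_fromCols] at h2
  exact (Matrix.fromCols_inj h2).2.trans (Matrix.mul_zero U)

lemma mul_toCols₁_mul_conjTranspose (hV : V * Vᴴ = 1) {m : Type*}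
    {B : Matrix m (Fin Na) ℂ} (hB : B * V.toCols₂ = 0) :
    B * V.toCols₁ * V.toCols₁ᴴ = B := by
  have h := congrArg (fun X => B * X) (toCols₁_mul_add hV)
  simp only [Matrix.mul_add, Matrix.mul_one, ← Matrix.mul_assoc, hB, Matrix.zero_mul,
    add_zero] at h
  exact h

/-- A channel that annihilates the artificial noise loses no capacity by the restriction to the
directions of the signal. -/
lemma logDet_mul_toCols₁ (hV : V * Vᴴ = 1) {m : Type*} [Fintype m] [DecidableEq m]
    {B : Matrix m (Fin Na) ℂ} (hB : B * V.toCols₂ = 0) (c : ℝ) :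
    logDet c (B * V.toCols₁) = logDet c B := by
  rw [logDet, logDet, Matrix.conjTranspose_mul, ← Matrix.mul_assoc,
    mul_toCols₁_mul_conjTranspose hV hB]

end Precoding

/-- With more antennas at Eve than artificial noise streams, the elimination is perfect. -/
lemma IsEliminator.mul_eq_zero {Ne k Nw : ℕ} (hk : k < Ne) {M : Matrix (Fin Ne) (Fin k) ℂ}
    {W : Matrix (Fin Nw) (Fin Ne) ℂ} (h : IsEliminator M W) : W * M = 0 := by
  obtain _ | n := Nw
  · ext i; exact i.elim0
  -- A competitor with zero residual power: all rows vanish, except for one multiple of a vector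
  -- in the left kernel of `M`.
  obtain ⟨v, hv, hv0⟩ : ∃ v : Fin Ne → ℂ, v ᵥ* M = 0 ∧ v ≠ 0 := by
    have h1 := LinearMap.ker_ne_bot_of_finrank_lt (f := M.vecMulLinear) (by simpa using hk)
    obtain ⟨v, hv, hv0⟩ := Submodule.exists_mem_ne_zero_of_ne_bot h1
    exact ⟨v, by simpa using hv, hv0⟩
  set t : ℝ := ∑ i, ‖v i‖ ^ 2 with ht
  have htv : v ⬝ᵥ star v = (t : ℂ) := by
    rw [dotProduct, ht, Complex.ofReal_sum]
    refine Finset.sum_congr rfl fun i _ => ?_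
    rw [Pi.star_apply, RCLike.star_def, Complex.mul_conj, Complex.sq_norm]
  have ht0 : 0 < t := by
    obtain ⟨i, hi⟩ := Function.ne_iff.1 hv0
    exact Finset.sum_pos' (fun i _ => by positivity)
      ⟨i, Finset.mem_univ i, by have := norm_pos_iff.2 hi; positivity⟩
  set a : ℂ := ((Real.sqrt ((n + 1 : ℕ) / t) : ℝ) : ℂ) with ha
  have haa : a * star a = ((n + 1 : ℕ) : ℂ) / t := by
    rw [ha, RCLike.star_def, Complex.conj_ofReal, ← Complex.ofReal_mul,
      Real.mul_self_sqrt (by positivity)]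
    push_cast
    ring
  set e : Fin (n + 1) → ℂ := Pi.single 0 1 with he
  have hee : e ⬝ᵥ star e = 1 := by simp [he]
  have h1 := h.2 (Matrix.vecMulVec e (a • v)) (by
    rw [Matrix.conjTranspose_vecMulVec, Matrix.vecMulVec_mul_vecMulVec, Matrix.trace_vecMulVec,
      dotProduct_smul, hee, star_smul, smul_dotProduct, dotProduct_smul, htv, smul_eq_mul,
      smul_eq_mul, smul_eq_mul, mul_one, ← mul_assoc, haa]
    have : (t : ℂ) ≠ 0 := by exact_mod_cast ht0.ne'
    field_simp)
  have h2 : Matrix.vecMulVec e (a • v) * M = 0 := by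
    rw [Matrix.vecMulVec_mul, Matrix.smul_vecMul, hv, smul_zero]
    ext i j
    simp [Matrix.vecMulVec_apply]
  rw [residualPower, residualPower, h2, Matrix.zero_mul, Matrix.zero_mul, Matrix.trace_zero,
    Complex.zero_re, Matrix.mul_assoc, ← Matrix.conjTranspose_mul, Matrix.trace_mul_comm,
    re_trace_conjTranspose_mul_self] at h1
  have h3 := le_antisymm h1
    (Finset.sum_nonneg fun i _ => Finset.sum_nonneg fun j _ => by positivity)
  rw [Finset.sum_eq_zero_iff_of_nonneg
    fun i _ => Finset.sum_nonneg fun j _ => by positivity] at h3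
  ext i j
  have h4 := (Finset.sum_eq_zero_iff_of_nonneg fun j _ => by positivity).1
    (h3 i (Finset.mem_univ i)) j (Finset.mem_univ j)
  simpa using h4

section Rates

variable {Na Nb Ne Nw : ℕ} {σs2 σr2 : ℝ≥0}

lemma bobInfo_eq {σu2 : ℝ≥0} (hu : 0 < σu2) {H : Matrix (Fin Nb) (Fin Na) ℂ}
    {V : Matrix (Fin Na) (Fin Nb ⊕ Fin (Na - Nb)) ℂ} (h : IsRightSingular H V) :
    bobInfo σs2 σr2 σu2 H V =
      ENNReal.ofReal (logDet (σs2 / σu2) H) / ENNReal.ofReal (Real.log 2) := by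
  rw [bobInfo, mutualInfo_eq σs2 σr2 hu (H * V.toCols₁)
    (D := (1 : Matrix (Fin Nb) (Fin Nb) ℂ)) (by simp), logDet_mul_toCols₁ h.2.1 h.mul_toCols₂]
  intro ω
  rw [transmit, Matrix.mulVec_add, Matrix.mulVec_mulVec, Matrix.mulVec_mulVec, h.mul_toCols₂,
    Matrix.zero_mulVec, add_zero, Matrix.one_mulVec]

lemma eveInfo_eq {σn2 : ℝ≥0} (hn : 0 < σn2) (G : Matrix (Fin Ne) (Fin Na) ℂ)
    (V : Matrix (Fin Na) (Fin Nb ⊕ Fin (Na - Nb)) ℂ) {W : Matrix (Fin Nw) (Fin Ne) ℂ}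
    (hW : W * Wᴴ = 1) (hWM : W * (G * V.toCols₂) = 0) :
    eveInfo σs2 σr2 σn2 G V W =
      ENNReal.ofReal (logDet (σs2 / σn2) (W * (G * V.toCols₁))) /
        ENNReal.ofReal (Real.log 2) := by
  rw [eveInfo, mutualInfo_eq σs2 σr2 hn (W * (G * V.toCols₁)) hW]
  intro ω
  simp only [transmit, Matrix.mulVec_add, Matrix.mulVec_mulVec]
  rw [hWM, Matrix.zero_mulVec,
    add_zero]

end Rates

/-! ### Eve's rate as an explicit function of the channels -/

section Formula

variable {Na Nb Ne Nw : ℕ}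

/-- The matrix `H adj(Gᴴ G) Hᴴ`: up to the factor `det (Gᴴ G)`, the form `H (Gᴴ G)⁻¹ Hᴴ` without
a division. -/
def adjForm (H : Matrix (Fin Nb) (Fin Na) ℂ) (G : Matrix (Fin Ne) (Fin Na) ℂ) :
    Matrix (Fin Nb) (Fin Nb) ℂ :=
  H * (Gᴴ * G).adjugate * Hᴴ

/-- Eve's capacity, in nats, as a function of the channels that involves neither the right singular
vectors nor the elimination matrix. It is valid for channels of full rank, and clears the
denominators of `det (c H Hᴴ + H (Gᴴ G)⁻¹ Hᴴ) / det (H (Gᴴ G)⁻¹ Hᴴ)`. -/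
noncomputable def eveLogDet (c : ℝ) (H : Matrix (Fin Nb) (Fin Na) ℂ)
    (G : Matrix (Fin Ne) (Fin Na) ℂ) : ℝ :=
  Real.log (Matrix.det (adjForm H G + ((c : ℂ) * (Gᴴ * G).det) • (H * Hᴴ)) /
    Matrix.det (adjForm H G)).re

/-- If `W` has orthonormal rows that span the left kernel of a matrix `M` of full column rank, then
`Wᴴ W` is the projection `1 - M (Mᴴ M)⁻¹ Mᴴ`. -/
lemma conjTranspose_mul_add_eq_one {k : ℕ} (hcard : Nw + k = Ne) {M : Matrix (Fin Ne) (Fin k) ℂ}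
    {W : Matrix (Fin Nw) (Fin Ne) ℂ} (hW : W * Wᴴ = 1) (hWM : W * M = 0)
    (hM : IsUnit (Mᴴ * M).det) : Wᴴ * W + M * ((Mᴴ * M)⁻¹ * Mᴴ) = 1 := by
  have h0 : Mᴴ * Wᴴ = 0 := by rw [← Matrix.conjTranspose_mul, hWM, Matrix.conjTranspose_zero]
  have h1 : Matrix.fromRows W ((Mᴴ * M)⁻¹ * Mᴴ) * Matrix.fromCols Wᴴ M = 1 := by
    rw [Matrix.fromRows_mul_fromCols, hW, hWM, Matrix.mul_assoc, h0, Matrix.mul_zero,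
      Matrix.mul_assoc, Matrix.nonsing_inv_mul _ hM, Matrix.fromBlocks_one]
  rw [← Matrix.fromCols_mul_fromRows]
  exact (Matrix.mul_eq_one_comm_of_card_eq _ _ _ (by simp [hcard])).1 h1

open scoped ComplexOrder in
lemma isUnit_det_conjTranspose_mul {m n l : Type*} [Fintype m] [Fintype n] [Fintype l]
    [DecidableEq n] [DecidableEq l] {G : Matrix m n ℂ} (hG : IsUnit (Gᴴ * G).det)
    {X : Matrix n l ℂ} (hX : Xᴴ * X = 1) : IsUnit ((G * X)ᴴ * (G * X)).det := by
  have h1 : (Gᴴ * G).PosDef :=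
    (Matrix.posSemidef_conjTranspose_mul_self G).posDef_iff_det_ne_zero.2 hG.ne_zero
  have h2 := h1.conjTranspose_mul_mul_same (B := X) fun x y hxy => by
    have := congrArg (fun z => Xᴴ *ᵥ z) hxy
    simpa [Matrix.mulVec_mulVec, hX] using this
  rw [Matrix.conjTranspose_mul, Matrix.mul_assoc, ← Matrix.mul_assoc Gᴴ, ← Matrix.mul_assoc]
  exact h2.det_pos.ne'.isUnit

lemma logDet_eq_eveLogDet (hk : Nw + (Na - Nb) = Ne) {H : Matrix (Fin Nb) (Fin Na) ℂ}
    {V : Matrix (Fin Na) (Fin Nb ⊕ Fin (Na - Nb)) ℂ} (hV : IsRightSingular H V)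
    {G : Matrix (Fin Ne) (Fin Na) ℂ} {W : Matrix (Fin Nw) (Fin Ne) ℂ} (hW : W * Wᴴ = 1)
    (hWM : W * (G * V.toCols₂) = 0) (hH : IsUnit (H * Hᴴ).det) (hG : IsUnit (Gᴴ * G).det)
    (c : ℝ) : logDet c (W * (G * V.toCols₁)) = eveLogDet c H G := by
  obtain ⟨v11, -, v21, v22⟩ := conjTranspose_toCols_mul hV.1
  have hproj := conjTranspose_mul_add_eq_one hk hW hWM
    (isUnit_det_conjTranspose_mul hG v22)
  have hC := mul_toCols₁_mul_conjTranspose hV.2.1 (B := W * G) (by rwa [Matrix.mul_assoc])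
  have hHE := mul_toCols₁_mul_conjTranspose hV.2.1 hV.mul_toCols₂
  set V₁ := V.toCols₁
  set V₀ := V.toCols₂
  set B := Gᴴ * G with hB
  set M := G * V₀ with hM
  set E := H * V₁ with hE
  set C := W * (G * V₁) with hCdef
  set K := V₁ᴴ * B⁻¹ * V₁ with hK
  have hBB : B * B⁻¹ = 1 := Matrix.mul_nonsing_inv _ hG
  -- The Gram matrix of Eve's channel after elimination is a Schur complement of `Vᴴ Gᴴ G V`,
  -- hence the inverse of a block of `Vᴴ (Gᴴ G)⁻¹ V`.
  have hDK : Cᴴ * C * K = 1 := by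
    have e1 : C * V₁ᴴ = W * G := by rw [hCdef, ← Matrix.mul_assoc, hC]
    have e2 : Cᴴ * (W * G) = V₁ᴴ * B - V₁ᴴ * Gᴴ * M * ((Mᴴ * M)⁻¹ * (V₀ᴴ * B)) := by
      have : Wᴴ * W = 1 - M * ((Mᴴ * M)⁻¹ * Mᴴ) := eq_sub_of_add_eq hproj
      calc Cᴴ * (W * G) = V₁ᴴ * Gᴴ * (Wᴴ * W) * G := by
            simp only [hCdef, Matrix.conjTranspose_mul, Matrix.mul_assoc]
        _ = _ := by
            rw [this, Matrix.mul_sub, Matrix.sub_mul]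
            simp only [hB, hM, Matrix.conjTranspose_mul, Matrix.mul_assoc, Matrix.mul_one]
    calc Cᴴ * C * K = Cᴴ * (C * V₁ᴴ) * B⁻¹ * V₁ := by simp only [hK, Matrix.mul_assoc]
      _ = V₁ᴴ * (B * B⁻¹) * V₁ -
          V₁ᴴ * Gᴴ * M * ((Mᴴ * M)⁻¹ * (V₀ᴴ * (B * B⁻¹) * V₁)) := by
          rw [e1, e2]
          simp only [Matrix.sub_mul, Matrix.mul_assoc]
      _ = 1 := by
          rw [hBB, Matrix.mul_one, Matrix.mul_one, v11, v21, Matrix.mul_zero, Matrix.mul_zero,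
            sub_zero]
  have hKD : K * (Cᴴ * C) = 1 := mul_eq_one_comm.1 hDK
  have hHH : H * Hᴴ = E * Eᴴ := by
    rw [hE, Matrix.conjTranspose_mul, ← Matrix.mul_assoc, hHE]
  have hP : adjForm H G = B.det • (E * K * Eᴴ) := by
    have e1 : B.adjugate = B.det • B⁻¹ := by
      rw [Matrix.inv_def, smul_smul, Ring.mul_inverse_cancel _ hG, one_smul]
    rw [adjForm, ← hB, e1]
    nth_rewrite 1 2 [← hHE]
    simp only [hK, Matrix.mul_smul, Matrix.smul_mul, Matrix.conjTranspose_mul,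
      Matrix.conjTranspose_conjTranspose, Matrix.mul_assoc]
  have hsum : adjForm H G + ((c : ℂ) * B.det) • (H * Hᴴ) =
      B.det • (E * K * (1 + (c : ℂ) • (Cᴴ * C)) * Eᴴ) := by
    rw [hP, hHH, Matrix.mul_add, Matrix.add_mul, smul_add, Matrix.mul_one, Matrix.mul_smul,
      Matrix.mul_assoc E K (Cᴴ * C), hKD, Matrix.mul_one, Matrix.smul_mul, smul_smul,
      mul_comm (c : ℂ)]
  have hE0 : E.det ≠ 0 ∧ Eᴴ.det ≠ 0 := by
    rw [hHH, Matrix.det_mul] at hH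
    exact mul_ne_zero_iff.1 hH.ne_zero
  have hK0 : K.det ≠ 0 := by
    have := congrArg Matrix.det hKD
    rw [Matrix.det_mul, Matrix.det_one] at this
    exact left_ne_zero_of_mul_eq_one this
  have hratio : Matrix.det (adjForm H G + ((c : ℂ) * B.det) • (H * Hᴴ)) /
      Matrix.det (adjForm H G) = Matrix.det (1 + (c : ℂ) • (Cᴴ * C)) := by
    have hBn : B.det ^ Fintype.card (Fin Nb) ≠ 0 := pow_ne_zero _ hG.ne_zero
    rw [hsum, hP, Matrix.det_smul, Matrix.det_smul, Matrix.det_mul, Matrix.det_mul,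
      Matrix.det_mul, Matrix.det_mul, Matrix.det_mul]
    have h1 := hE0.1
    have h2 := hE0.2
    field_simp
  rw [eveLogDet, ← hB, hratio, ← logDet_conjTranspose, logDet, Matrix.conjTranspose_conjTranspose]

end Formula

/-! ### Rayleigh-fading channels have full rank almost surely -/

lemma continuous_of {r c : ℕ} :
    Continuous fun x : Fin r → Fin c → ℂ => (Matrix.of x : Matrix (Fin r) (Fin c) ℂ) :=
  continuous_id

/-- A square block of a channel matrix is almost surely invertible: on a line in the direction of
the identity of that block, its determinant is a nonzero polynomial. -/
lemma ae_det_submatrix_ne_zero {r c n : ℕ} (hr : n ≤ r) (hc : n ≤ c) :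
    ∀ᵐ x ∂(rayleigh r c),
      ((Matrix.of x).submatrix (Fin.castLE hr) (Fin.castLE hc)).det ≠ 0 := by
  refine (rayleigh_absolutelyContinuous r c).ae_le ?_
  set f : (Fin r → Fin c → ℂ) → ℂ := fun x =>
    ((Matrix.of x).submatrix (Fin.castLE hr) (Fin.castLE hc)).det with hf
  have hfc : Continuous f := (continuous_of.matrix_submatrix _ _).matrix_det
  set D : Fin r → Fin c → ℂ := fun i j => if (i : ℕ) = j then 1 else 0 with hD
  have hline : ∀ x, ∀ᵐ t : ℝ ∂volume, f (x + t • D) ≠ 0 := by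
    intro x
    set X := (Matrix.of x).submatrix (Fin.castLE hr) (Fin.castLE hc) with hX
    have h1 : ∀ t : ℝ, f (x + t • D) = (-X).charpoly.eval (t : ℂ) := by
      intro t
      rw [Matrix.eval_charpoly]
      simp only [hf]
      congr 1
      ext i j
      by_cases hij : i = j
      · subst hij
        simp [hD, hX]
        ring
      · have : (i : ℕ) ≠ j := fun h => hij (Fin.ext h)
        simp [hD, hX, hij, this]
    have hfin : {t : ℝ | f (x + t • D) = 0}.Finite := by
      refine Set.Finite.subset (Set.Finite.preimage Complex.ofReal_injective.injOn
        ((-X).charpoly.roots.toFinset.finite_toSet)) fun t ht => ?_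
      have ht' : (-X).charpoly.eval (t : ℂ) = 0 := (h1 t).symm.trans ht
      simpa [Matrix.charpoly_monic _ |>.ne_zero] using ht'
    rw [ae_iff]
    simpa using hfin.measure_zero volume
  have hmeas : MeasurableSet {p : (Fin r → Fin c → ℂ) × ℝ | f (p.1 + p.2 • D) ≠ 0} :=
    (hfc.comp (continuous_fst.add (continuous_snd.smul continuous_const))).measurable
      (measurableSet_singleton 0).compl
  obtain ⟨t, ht⟩ := ((Measure.ae_ae_comm hmeas).1
    (Filter.Eventually.of_forall (f := ae volume) hline)).exists
  have h2 := (measurePreserving_add_right volume (-(t • D))).quasiMeasurePreserving.ae ht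
  filter_upwards [h2] with x hx
  rwa [neg_add_cancel_right] at hx

open scoped ComplexOrder in
lemma isUnit_det_gram_of_submatrix {r c : ℕ} (h : c ≤ r) (G : Matrix (Fin r) (Fin c) ℂ)
    (hG : (G.submatrix (Fin.castLE h) id).det ≠ 0) : IsUnit (Gᴴ * G).det := by
  refine (Matrix.PosDef.conjTranspose_mul_self G fun x y hxy => ?_).det_pos.ne'.isUnit
  have h1 : ∀ z, G.submatrix (Fin.castLE h) id *ᵥ z = fun i => (G *ᵥ z) (Fin.castLE h i) :=
    fun z => rfl
  have h2 : G.submatrix (Fin.castLE h) id *ᵥ (x - y) = 0 := by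
    rw [Matrix.mulVec_sub, h1, h1]
    rw [show G *ᵥ x = G *ᵥ y from hxy, sub_self]
  exact sub_eq_zero.1 (Matrix.eq_zero_of_mulVec_eq_zero hG h2)

lemma ae_isUnit_det_conjTranspose_mul {r c : ℕ} (h : c ≤ r) :
    ∀ᵐ x ∂(rayleigh r c), IsUnit ((Matrix.of x)ᴴ * Matrix.of x).det := by
  filter_upwards [ae_det_submatrix_ne_zero h le_rfl] with x hx
  exact isUnit_det_gram_of_submatrix h _ hx

lemma ae_isUnit_det_mul_conjTranspose {r c : ℕ} (h : r ≤ c) :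
    ∀ᵐ x ∂(rayleigh r c), IsUnit (Matrix.of x * (Matrix.of x)ᴴ).det := by
  filter_upwards [ae_det_submatrix_ne_zero le_rfl h] with x hx
  have h1 := isUnit_det_gram_of_submatrix h (Matrix.of x)ᴴ (by
    have h2 : ((Matrix.of x)ᴴ.submatrix (Fin.castLE h) id) =
      ((Matrix.of x).submatrix (Fin.castLE le_rfl) (Fin.castLE h))ᴴ := rfl
    rw [h2, Matrix.det_conjTranspose]
    exact star_ne_zero.2 hx)
  rwa [Matrix.conjTranspose_conjTranspose] at h1

/-! ### Invariance of the Rayleigh-fading channel -/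

lemma measurable_of_continuous {r c : ℕ} {E : Type*} [TopologicalSpace E] [MeasurableSpace E]
    [OpensMeasurableSpace E] {f : E → Matrix (Fin r) (Fin c) ℂ} (hf : Continuous f) :
    Measurable fun x i j => f x i j :=
  (show Continuous fun x i j => f x i j from hf).measurable

lemma continuous_exp_trace {r c : ℕ} (a : Matrix (Fin r) (Fin c) ℂ) :
    Continuous fun x : Fin r → Fin c → ℂ =>
      Complex.exp ((Matrix.trace (aᴴ * Matrix.of x)).re * Complex.I) :=
  Complex.continuous_exp.comp ((Complex.continuous_ofReal.comp (Complex.continuous_re.comp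
    (Continuous.matrix_trace (continuous_const.matrix_mul continuous_of)))).mul continuous_const)

/-- Projecting the rows of a Rayleigh-fading channel gives a Rayleigh-fading channel. -/
lemma measurePreserving_mul_left {q m c : ℕ} {Q : Matrix (Fin q) (Fin m) ℂ} (hQ : Q * Qᴴ = 1) :
    MeasurePreserving (fun x : Fin m → Fin c → ℂ => fun i j => (Q * Matrix.of x) i j)
      (rayleigh m c) (rayleigh q c) := by
  have hm : Measurable fun x : Fin m → Fin c → ℂ => fun i j => (Q * Matrix.of x) i j :=
    measurable_of_continuous (continuous_const.matrix_mul continuous_of)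
  refine ⟨hm, ?_⟩
  have := Measure.isProbabilityMeasure_map (μ := rayleigh m c) hm.aemeasurable
  refine eq_rayleigh _ fun a => ?_
  rw [integral_map hm.aemeasurable (continuous_exp_trace a).aestronglyMeasurable]
  have h1 : ∀ x : Fin m → Fin c → ℂ,
      aᴴ * Matrix.of (fun i j => (Q * Matrix.of x) i j) = (Qᴴ * a)ᴴ * Matrix.of x := by
    intro x
    rw [Matrix.conjTranspose_mul, Matrix.conjTranspose_conjTranspose, Matrix.mul_assoc]
    rfl
  simp_rw [h1]
  rw [integral_exp_rayleigh, Matrix.conjTranspose_mul, Matrix.conjTranspose_conjTranspose,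
    Matrix.mul_assoc, ← Matrix.mul_assoc Q, hQ, Matrix.one_mul]

lemma measurePreserving_transpose (r c : ℕ) :
    MeasurePreserving (fun (x : Fin r → Fin c → ℂ) j i => x i j) (rayleigh r c)
      (rayleigh c r) := by
  have hm : Measurable fun (x : Fin r → Fin c → ℂ) j i => x i j := by fun_prop
  refine ⟨hm, ?_⟩
  have := Measure.isProbabilityMeasure_map (μ := rayleigh r c) hm.aemeasurable
  refine eq_rayleigh _ fun a => ?_
  rw [integral_map hm.aemeasurable (continuous_exp_trace a).aestronglyMeasurable]
  have h1 : ∀ x : Fin r → Fin c → ℂ,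
      (aᴴ * Matrix.of (fun j i => x i j)).trace = (aᵀᴴ * Matrix.of x).trace := by
    intro x
    rw [← Matrix.trace_transpose, Matrix.transpose_mul, Matrix.trace_mul_comm]
    rfl
  simp_rw [h1]
  rw [integral_exp_rayleigh, re_trace_conjTranspose_mul_self, re_trace_conjTranspose_mul_self,
    Finset.sum_comm]
  rfl

/-- In the coordinates of a unitary matrix `V`, the blocks of a Rayleigh-fading channel are
independent Rayleigh-fading channels. -/
lemma measurePreserving_recombine {Na Nb Ne : ℕ}
    {V : Matrix (Fin Na) (Fin Nb ⊕ Fin (Na - Nb)) ℂ} (hV : V * Vᴴ = 1) :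
    MeasurePreserving (fun (p : (Fin Ne → Fin (Na - Nb) → ℂ) × (Fin Ne → Fin Nb → ℂ)) i j =>
        (Matrix.of p.1 * V.toCols₂ᴴ + Matrix.of p.2 * V.toCols₁ᴴ) i j)
      ((rayleigh Ne (Na - Nb)).prod (rayleigh Ne Nb)) (rayleigh Ne Na) := by
  have hm : Measurable
      (fun (p : (Fin Ne → Fin (Na - Nb) → ℂ) × (Fin Ne → Fin Nb → ℂ)) i j =>
        (Matrix.of p.1 * V.toCols₂ᴴ + Matrix.of p.2 * V.toCols₁ᴴ) i j) :=
    measurable_of_continuous (((continuous_of.comp continuous_fst).matrix_mul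
      continuous_const).add ((continuous_of.comp continuous_snd).matrix_mul continuous_const))
  refine ⟨hm, ?_⟩
  have := Measure.isProbabilityMeasure_map
    (μ := (rayleigh Ne (Na - Nb)).prod (rayleigh Ne Nb)) hm.aemeasurable
  refine eq_rayleigh _ fun a => ?_
  rw [integral_map hm.aemeasurable (continuous_exp_trace a).aestronglyMeasurable]
  have h1 : ∀ p : (Fin Ne → Fin (Na - Nb) → ℂ) × (Fin Ne → Fin Nb → ℂ),
      (aᴴ * Matrix.of (fun i j =>
        (Matrix.of p.1 * V.toCols₂ᴴ + Matrix.of p.2 * V.toCols₁ᴴ) i j)).trace =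
      ((a * V.toCols₂)ᴴ * Matrix.of p.1).trace + ((a * V.toCols₁)ᴴ * Matrix.of p.2).trace := by
    intro p
    change (aᴴ * (Matrix.of p.1 * V.toCols₂ᴴ + Matrix.of p.2 * V.toCols₁ᴴ)).trace = _
    rw [Matrix.mul_add, Matrix.trace_add, ← Matrix.mul_assoc, ← Matrix.mul_assoc,
      Matrix.trace_mul_comm, Matrix.trace_mul_comm (aᴴ * Matrix.of p.2),
      Matrix.conjTranspose_mul, Matrix.conjTranspose_mul, Matrix.mul_assoc, Matrix.mul_assoc]
  simp_rw [h1, Complex.add_re, Complex.ofReal_add, add_mul, Complex.exp_add]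
  rw [integral_prod_mul (fun x : Fin Ne → Fin (Na - Nb) → ℂ =>
      Complex.exp ((((a * V.toCols₂)ᴴ * Matrix.of x).trace).re * Complex.I))
    (fun x : Fin Ne → Fin Nb → ℂ =>
      Complex.exp ((((a * V.toCols₁)ᴴ * Matrix.of x).trace).re * Complex.I)),
    integral_exp_rayleigh, integral_exp_rayleigh, ← Complex.exp_add, ← Complex.ofReal_neg,
    ← Complex.ofReal_neg, ← Complex.ofReal_neg, ← Complex.ofReal_add]
  congr 2
  have h2 : (aᴴ * a).trace = ((a * V.toCols₂)ᴴ * (a * V.toCols₂)).trace +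
      ((a * V.toCols₁)ᴴ * (a * V.toCols₁)).trace := by
    rw [Matrix.trace_mul_comm, Matrix.trace_mul_comm (a * V.toCols₂)ᴴ,
      Matrix.trace_mul_comm (a * V.toCols₁)ᴴ, ← Matrix.trace_add, Matrix.conjTranspose_mul,
      Matrix.conjTranspose_mul, Matrix.mul_assoc, Matrix.mul_assoc, ← Matrix.mul_add,
      ← Matrix.mul_assoc V.toCols₂, ← Matrix.mul_assoc V.toCols₁, ← Matrix.add_mul, add_comm,
      toCols₁_mul_add hV, Matrix.one_mul]
  rw [h2, Complex.add_re]
  ring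

/-! ### Average rates -/

lemma measurable_logDet {r c : ℕ} (d : ℝ) :
    Measurable fun x : Fin r → Fin c → ℂ => logDet d (Matrix.of x) := by
  refine Real.measurable_log.comp (Complex.measurable_re.comp (Continuous.measurable ?_))
  have h : Continuous fun x : Fin r → Fin c → ℂ => Matrix.of x * (Matrix.of x)ᴴ :=
    continuous_of.matrix_mul continuous_of.matrix_conjTranspose
  exact (continuous_const.add (h.const_smul (d : ℂ))).matrix_det

lemma measurable_eveLogDet {Na Nb Ne : ℕ} (d : ℝ) :
    Measurable fun hg : (Fin Nb → Fin Na → ℂ) × (Fin Ne → Fin Na → ℂ) =>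
      eveLogDet d (Matrix.of hg.1) (Matrix.of hg.2) := by
  have hH : Continuous fun hg : (Fin Nb → Fin Na → ℂ) × (Fin Ne → Fin Na → ℂ) =>
      (Matrix.of hg.1 : Matrix (Fin Nb) (Fin Na) ℂ) := continuous_of.comp continuous_fst
  have hG : Continuous fun hg : (Fin Nb → Fin Na → ℂ) × (Fin Ne → Fin Na → ℂ) =>
      (Matrix.of hg.2 : Matrix (Fin Ne) (Fin Na) ℂ) := continuous_of.comp continuous_snd
  have hB := hG.matrix_conjTranspose.matrix_mul hG
  have hP := (hH.matrix_mul hB.matrix_adjugate).matrix_mul hH.matrix_conjTranspose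
  refine Real.measurable_log.comp (Complex.measurable_re.comp
    (Measurable.div (Continuous.measurable ?_) hP.matrix_det.measurable))
  exact (hP.add ((continuous_const.mul hB.matrix_det).smul
    (hH.matrix_mul hH.matrix_conjTranspose))).matrix_det

lemma ofReal_div_log_two_mono {x y : ℝ} (h : x ≤ y) :
    ENNReal.ofReal x / ENNReal.ofReal (Real.log 2) ≤
      ENNReal.ofReal y / ENNReal.ofReal (Real.log 2) :=
  ENNReal.div_le_div_right (ENNReal.ofReal_le_ofReal h) _

lemma ofReal_log_two_ne_zero : ENNReal.ofReal (Real.log 2) ≠ 0 :=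
  (ENNReal.ofReal_pos.2 (Real.log_pos one_lt_two)).ne'

lemma lintegral_power_ne_top {r c : ℕ} (d : ℝ) :
    ∫⁻ x, ENNReal.ofReal (d * ∑ i, ∑ j, ‖x i j‖ ^ 2) / ENNReal.ofReal (Real.log 2)
      ∂(rayleigh r c) ≠ ∞ := by
  have h1 := ((integrable_sum_norm_sq_rayleigh r c).const_mul d).lintegral_lt_top.ne
  simp_rw [div_eq_mul_inv]
  rw [lintegral_mul_const' _ _ (ENNReal.inv_ne_top.2 ofReal_log_two_ne_zero)]
  exact ENNReal.mul_ne_top h1 (ENNReal.inv_ne_top.2 ofReal_log_two_ne_zero)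

section Average

variable {Na Nb Ne Nw : ℕ} {σs2 σr2 σu2 σn2 : ℝ≥0}
  {V : Matrix (Fin Nb) (Fin Na) ℂ → Matrix (Fin Na) (Fin Nb ⊕ Fin (Na - Nb)) ℂ}
  {W : Matrix (Fin Ne) (Fin (Na - Nb)) ℂ → Matrix (Fin Nw) (Fin Ne) ℂ}

lemma bobRate_eq (hu : 0 < σu2) (hV : ∀ H, IsRightSingular H (V H)) :
    bobRate σs2 σr2 σu2 V = fun h =>
      ENNReal.ofReal (logDet (σs2 / σu2) (Matrix.of h)) / ENNReal.ofReal (Real.log 2) :=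
  funext fun h => bobInfo_eq hu (hV (Matrix.of h))

lemma measurable_bobRate (hu : 0 < σu2) (hV : ∀ H, IsRightSingular H (V H)) :
    Measurable (bobRate σs2 σr2 σu2 V) := by
  rw [bobRate_eq hu hV]
  exact (measurable_logDet _).ennreal_ofReal.div_const _

lemma avgBobRate_ne_top (hu : 0 < σu2) (hV : ∀ H, IsRightSingular H (V H)) :
    avgBobRate σs2 σr2 σu2 V ≠ ∞ := by
  rw [avgBobRate, bobRate_eq hu hV]
  exact ne_top_of_le_ne_top (lintegral_power_ne_top (σs2 / σu2 : ℝ))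
    (lintegral_mono fun x => ofReal_div_log_two_mono (logDet_le (by positivity) _))

/-- Bob's average rate is that of the transposed channel, whose rows are indexed by Alice's
antennas. -/
lemma avgBobRate_eq_transpose (hu : 0 < σu2) (hV : ∀ H, IsRightSingular H (V H)) :
    avgBobRate σs2 σr2 σu2 V = ∫⁻ y, ENNReal.ofReal (logDet (σs2 / σu2) (Matrix.of y)) /
      ENNReal.ofReal (Real.log 2) ∂(rayleigh Na Nb) := by
  rw [avgBobRate, bobRate_eq hu hV, ← (measurePreserving_transpose Nb Na).lintegral_comp
    ((measurable_logDet _).ennreal_ofReal.div_const _)]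
  exact lintegral_congr fun x => by rw [← logDet_transpose]; rfl

lemma eveRate_eq (hn : 0 < σn2) (hW : ∀ M, IsEliminator M (W M)) (hk : Na - Nb < Ne)
    (hg : (Fin Nb → Fin Na → ℂ) × (Fin Ne → Fin Na → ℂ)) :
    eveRate σs2 σr2 σn2 V W hg =
      ENNReal.ofReal (logDet (σs2 / σn2) (W (Matrix.of hg.2 * (V (Matrix.of hg.1)).toCols₂) *
        (Matrix.of hg.2 * (V (Matrix.of hg.1)).toCols₁))) / ENNReal.ofReal (Real.log 2) :=
  eveInfo_eq hn _ _ (hW _).1 ((hW _).mul_eq_zero hk)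

/-- Almost surely, Eve's rate does not depend on the choices of `V` and `W`. -/
lemma eveRate_ae_eq (hn : 0 < σn2) (hV : ∀ H, IsRightSingular H (V H))
    (hW : ∀ M, IsEliminator M (W M)) (hk : Na - Nb < Ne) (hNw : Nw + (Na - Nb) = Ne)
    (hba : Nb ≤ Na) (hae : Na ≤ Ne) :
    eveRate σs2 σr2 σn2 V W =ᵐ[(rayleigh Nb Na).prod (rayleigh Ne Na)] fun hg =>
      ENNReal.ofReal (eveLogDet (σs2 / σn2) (Matrix.of hg.1) (Matrix.of hg.2)) /
        ENNReal.ofReal (Real.log 2) := by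
  filter_upwards [Measure.quasiMeasurePreserving_fst.ae (ae_isUnit_det_mul_conjTranspose hba),
    Measure.quasiMeasurePreserving_snd.ae (ae_isUnit_det_conjTranspose_mul hae)] with hg h1 h2
  rw [eveRate_eq hn hW hk, logDet_eq_eveLogDet hNw (hV _) (hW _).1 ((hW _).mul_eq_zero hk) h1 h2]

lemma measurable_eveLogDet_bits :
    Measurable fun hg : (Fin Nb → Fin Na → ℂ) × (Fin Ne → Fin Na → ℂ) =>
      ENNReal.ofReal (eveLogDet (σs2 / σn2) (Matrix.of hg.1) (Matrix.of hg.2)) /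
        ENNReal.ofReal (Real.log 2) :=
  (measurable_eveLogDet _).ennreal_ofReal.div_const _

lemma avgEveRate_ne_top (hn : 0 < σn2) (hV : ∀ H, IsRightSingular H (V H))
    (hW : ∀ M, IsEliminator M (W M)) (hk : Na - Nb < Ne) :
    avgEveRate σs2 σr2 σn2 V W ≠ ∞ := by
  have h1 : avgEveRate σs2 σr2 σn2 V W ≤
      ∫⁻ hg : (Fin Nb → Fin Na → ℂ) × (Fin Ne → Fin Na → ℂ),
        ENNReal.ofReal ((σs2 / σn2 : ℝ) * ∑ i, ∑ j, ‖hg.2 i j‖ ^ 2) /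
          ENNReal.ofReal (Real.log 2) ∂((rayleigh Nb Na).prod (rayleigh Ne Na)) := by
    refine lintegral_mono fun hg => ?_
    rw [eveRate_eq hn hW hk]
    refine ofReal_div_log_two_mono ?_
    rw [← Matrix.mul_assoc, logDet_mul_toCols₁ (hV _).2.1
      (by rw [Matrix.mul_assoc]; exact (hW _).mul_eq_zero hk)]
    exact (logDet_mul_le (by positivity) le_rfl (hW _).1 _).trans (logDet_le (by positivity) _)
  refine ne_top_of_le_ne_top ?_ h1
  rw [(measurePreserving_snd (μ := rayleigh Nb Na) (ν := rayleigh Ne Na)).lintegral_comp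
    (f := fun g => ENNReal.ofReal ((σs2 / σn2 : ℝ) * ∑ i, ∑ j, ‖g i j‖ ^ 2) /
      ENNReal.ofReal (Real.log 2)) (by fun_prop)]
  exact lintegral_power_ne_top _

/-- For every realization of `H`, Eve's rate averaged over `G` is at least Bob's average rate:
given `G V₀`, Eve sees `W G V₁`, which has at least `Na` rows of independent Gaussian entries. -/
lemma avgBobRate_le_lintegral (hu : 0 < σu2) (hn : 0 < σn2) (hnu : σn2 ≤ σu2)
    (hV : ∀ H, IsRightSingular H (V H)) (hW : ∀ M, IsEliminator M (W M)) (hk : Na - Nb < Ne)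
    (hNw : Na ≤ Nw) (h : Fin Nb → Fin Na → ℂ)
    (hm : AEMeasurable (fun g => eveRate σs2 σr2 σn2 V W (h, g)) (rayleigh Ne Na)) :
    avgBobRate σs2 σr2 σu2 V ≤ ∫⁻ g, eveRate σs2 σr2 σn2 V W (h, g) ∂(rayleigh Ne Na) := by
  have hVh := hV (Matrix.of h)
  obtain ⟨v11, v12, v21, v22⟩ := conjTranspose_toCols_mul hVh.1
  have hT := measurePreserving_recombine (Ne := Ne) hVh.2.1
  rw [← hT.map_eq] at hm ⊢
  rw [lintegral_map' hm hT.measurable.aemeasurable]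
  refine le_of_le_of_eq ?_ (lintegral_prod _ (hm.comp_measurable hT.measurable)).symm
  have hb : avgBobRate σs2 σr2 σu2 V =
      ∫⁻ _, avgBobRate σs2 σr2 σu2 V ∂(rayleigh Ne (Na - Nb)) := by simp
  rw [hb]
  refine lintegral_mono fun M => ?_
  set E : Matrix (Fin Na) (Fin Nw) ℂ :=
    (1 : Matrix (Fin Nw) (Fin Nw) ℂ).submatrix (Fin.castLE hNw) id with hE
  have hEE : E * Eᴴ = 1 := by
    rw [hE, Matrix.conjTranspose_submatrix, Matrix.conjTranspose_one,
      ← Matrix.submatrix_mul _ _ _ _ _ Function.bijective_id, Matrix.mul_one]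
    exact Matrix.submatrix_one _ (Fin.castLE_injective hNw)
  have hQ : (E * W (Matrix.of M)) * (E * W (Matrix.of M))ᴴ = 1 := by
    rw [Matrix.conjTranspose_mul, Matrix.mul_assoc, ← Matrix.mul_assoc (W (Matrix.of M)),
      (hW _).1, Matrix.one_mul, hEE]
  rw [avgBobRate_eq_transpose hu hV, ← (measurePreserving_mul_left hQ).lintegral_comp
    ((measurable_logDet _).ennreal_ofReal.div_const _)]
  refine lintegral_mono fun X => ?_
  refine le_of_le_of_eq ?_ (eveRate_eq hn hW hk _).symm
  refine ofReal_div_log_two_mono ?_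
  have e0 : (Matrix.of M * (V (Matrix.of h)).toCols₂ᴴ +
      Matrix.of X * (V (Matrix.of h)).toCols₁ᴴ) * (V (Matrix.of h)).toCols₂ = Matrix.of M := by
    rw [Matrix.add_mul, Matrix.mul_assoc, Matrix.mul_assoc, v22, v12, Matrix.mul_one,
      Matrix.mul_zero, add_zero]
  have e1 : (Matrix.of M * (V (Matrix.of h)).toCols₂ᴴ +
      Matrix.of X * (V (Matrix.of h)).toCols₁ᴴ) * (V (Matrix.of h)).toCols₁ = Matrix.of X := by
    rw [Matrix.add_mul, Matrix.mul_assoc, Matrix.mul_assoc, v21, v11, Matrix.mul_one,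
      Matrix.mul_zero, zero_add]
  change logDet _ (E * W (Matrix.of M) * Matrix.of X) ≤ logDet _
    (W ((Matrix.of M * (V (Matrix.of h)).toCols₂ᴴ +
      Matrix.of X * (V (Matrix.of h)).toCols₁ᴴ) * (V (Matrix.of h)).toCols₂) *
      ((Matrix.of M * (V (Matrix.of h)).toCols₂ᴴ +
      Matrix.of X * (V (Matrix.of h)).toCols₁ᴴ) * (V (Matrix.of h)).toCols₁))
  rw [e0, e1, Matrix.mul_assoc]
  have hn' : (0 : ℝ) < σn2 := hn
  exact logDet_mul_le (by positivity)
    (div_le_div_of_nonneg_left (by positivity) hn' (by exact_mod_cast hnu)) hEE _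

end Average

end Wiretap

theorem corollary1
    -- numbers of antennas at Alice, Bob and Eve
    (Na Nb Ne : ℕ) (hNb : Nb < Na)
    -- powers of signal, artificial noise, Bob's noise and Eve's noise
    (σs2 σr2 σu2 σn2 : ℝ≥0) (hs : 0 < σs2) (hu : 0 < σu2) (hn : 0 < σn2)
    -- Alice's right singular vectors and Eve's elimination matrix, for every choice of these
    (V : Matrix (Fin Nb) (Fin Na) ℂ → Matrix (Fin Na) (Fin Nb ⊕ Fin (Na - Nb)) ℂ)
    (hV : ∀ H, Wiretap.IsRightSingular H (V H))
    (W : Matrix (Fin Ne) (Fin (Na - Nb)) ℂ →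
      Matrix (Fin (Wiretap.aneDim Na Nb Ne)) (Fin Ne) ℂ)
    (hW : ∀ M, Wiretap.IsEliminator M (W M))
    -- the noise power ratio and the number of Eve's antennas
    (hγ : (σn2 : ℝ) / (σu2 : ℝ) ≤ (Nb : ℝ) / (Na : ℝ))
    (hNe : 2 * (Na : ℤ) - (Nb : ℤ) ≤ (Ne : ℤ)) :
    -- both average rates are well defined and finite, and the average secrecy rate vanishes
    AEMeasurable (Wiretap.bobRate σs2 σr2 σu2 V) (Wiretap.rayleigh Nb Na) ∧
    AEMeasurable (Wiretap.eveRate σs2 σr2 σn2 V W)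
      ((Wiretap.rayleigh Nb Na).prod (Wiretap.rayleigh Ne Na)) ∧
    Wiretap.avgBobRate σs2 σr2 σu2 V ≠ ∞ ∧
    Wiretap.avgEveRate σs2 σr2 σn2 V W ≠ ∞ ∧
    Wiretap.avgSecrecyRate σs2 σr2 σu2 σn2 V W = 0 := by
  have hk : Na - Nb < Ne := by omega
  have hdim : Wiretap.aneDim Na Nb Ne = Ne - (Na - Nb) := if_pos hk
  have hnu : σn2 ≤ σu2 := by
    have hu' : (0 : ℝ) < σu2 := hu
    have h1 : (Nb : ℝ) / Na ≤ 1 :=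
      div_le_one_of_le₀ (by exact_mod_cast hNb.le) (Nat.cast_nonneg _)
    exact_mod_cast (div_le_one hu').1 (hγ.trans h1)
  have hae := Wiretap.eveRate_ae_eq (σs2 := σs2) (σr2 := σr2) hn hV hW hk (by omega) hNb.le
    (by omega)
  have hmE : AEMeasurable (Wiretap.eveRate σs2 σr2 σn2 V W)
      ((Wiretap.rayleigh Nb Na).prod (Wiretap.rayleigh Ne Na)) :=
    ⟨_, Wiretap.measurable_eveLogDet_bits, hae⟩
  have htop := Wiretap.avgEveRate_ne_top (σs2 := σs2) (σr2 := σr2) hn hV hW hk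
  refine ⟨(Wiretap.measurable_bobRate hu hV).aemeasurable, hmE,
    Wiretap.avgBobRate_ne_top hu hV, htop, max_eq_right (sub_nonpos.2 ?_)⟩
  refine ENNReal.toReal_mono htop ?_
  have hb : Wiretap.avgBobRate σs2 σr2 σu2 V =
      ∫⁻ _, Wiretap.avgBobRate σs2 σr2 σu2 V ∂(Wiretap.rayleigh Nb Na) := by simp
  rw [hb, Wiretap.avgEveRate, lintegral_prod _ hmE]
  refine lintegral_mono_ae ?_
  filter_upwards [Measure.ae_ae_of_ae_prod hae] with h hh
  exact Wiretap.avgBobRate_le_lintegral hu hn hnu hV hW hk (by omega) h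
    ⟨_, Wiretap.measurable_eveLogDet_bits.comp measurable_prodMk_left, hh⟩
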